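/- Let $n\ge 3$, $a\neq 0$ and $B=aI_n$. Let $\Omega\subset\mathbb R^n$ be open and let $\tilde\Omega\subset\mathbb R^n$ be a bounded domain (a bounded connected open set, e.g. a bounded locally Lipschitz domain) with $\overline\Omega\subset\tilde\Omega$. Let $\rho\in C^1(\mathbb R^n)$ satisfy $\rho>0$ on $\mathbb R^n$ and $\rho(x)=\bar\rho$ (a constant) for $x\in\mathbb R^n\setminus\Omega$, and let $p\in C^1((0,\infty))$ satisfy $\int_\Omega p(\rho(x))\,dx=p(\bar\rho)\,|\Omega|$. Write $\mathbb S_0^{n\times n}$ for the symmetric trace-free real $n\times n$ matrices. Then there exist continuous functions $\tilde m:\mathbb R^n\to\mathbb R^n$, $\tilde U:\mathbb R^n\to\mathbb S_0^{n\times n}$ and a constant $\chi\in\mathbb R$ such that, with $q(x)=p(\rho(x))+\frac{\chi}{n}$, 1. $\operatorname{supp}(\tilde m,\tilde U)$ is a compact subset of $\tilde\Omega$; 2. $\operatorname{div}\tilde m=0$ and $\operatorname{div}\tilde U+\nabla q=B\tilde m$ on $\mathbb R^n$ in the sense of distributions; 3. $\tilde m(x)\otimes\tilde m(x)-\rho(x)\tilde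 U(x)<\rho(x)q(x)I_n$ for all $x\in\mathbb R^n$, in the sense of symmetric matrices. Moreover this is a compactly supported strict subsolution in the following sense. For $\alpha,\beta>0$ let $$K_{\alpha,\beta}=\Bigl\{(m,U)\in\mathbb R^n\times\mathbb S_0^{n\times n}:\ \tfrac{m\otimes m}{\alpha}-U=\beta I_n\Bigr\},$$ let $K_{\alpha,\beta}^{\mathrm{co}}$ be its convex hull, and take interiors in $\mathbb R^n\times\mathbb S_0^{n\times n}$. For all $x\in\mathbb R^n$ one has $q(x)>0$ and $(\tilde m,\tilde U)(x)$ lies in the interior of $K_{\rho(x),q(x)}^{\mathrm{co}}$. Also, with $r=\frac{\chi}{n}>0$, the quadruple $(\rho,\tilde m,\tilde U,r)$ is bounded and continuous, solves $$\operatorname{div}\tilde m=0,\qquad \operatorname{div}\tilde U+\nabla(p(\rho)+r)=B\tilde m$$ in the sense of distributions, and $(\tilde m,\tilde U)(x)$ lies in the interior of $K_{\rho(x),r}^{\mathrm{co}}$ for all $x\in\mathbb R^n$. -/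

import Mathlib

open MeasureTheory

noncomputable section

namespace SteadyEuler

/-- `ℝⁿ` with its Euclidean norm and Lebesgue measure. -/
abbrev E (n : ℕ) : Type := EuclideanSpace ℝ (Fin n)

/-- The space of real symmetric trace-free `n × n` matrices. -/
def SymTraceless (n : ℕ) : Submodule ℝ (Matrix (Fin n) (Fin n) ℝ) where
  carrier := {A | A.transpose = A ∧ A.trace = 0}
  add_mem' := by
    rintro A B ⟨hA, hA'⟩ ⟨hB, hB'⟩
    exact ⟨by rw [Matrix.transpose_add, hA, hB], by rw [Matrix.trace_add, hA', hB', add_zero]⟩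
  zero_mem' := ⟨Matrix.transpose_zero, Matrix.trace_zero _ _⟩
  smul_mem' := by
    rintro c A ⟨hA, hA'⟩
    exact ⟨by rw [Matrix.transpose_smul, hA], by rw [Matrix.trace_smul, hA', smul_zero]⟩

/-- The rank one matrix `m ⊗ m`. -/
def tensorSq {n : ℕ} (m : E n) : Matrix (Fin n) (Fin n) ℝ :=
  Matrix.of fun i j => m i * m j

/-- The constraint set `K_{a,b}` of all pairs `(m, U)` with `(m ⊗ m) / a - U = b I`. -/
def constraintSet (n : ℕ) (a b : ℝ) : Set (E n × SymTraceless n) :=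
  {w | a⁻¹ • tensorSq w.1 - (w.2 : Matrix (Fin n) (Fin n) ℝ) = b • 1}

/-- The partial derivative `∂ψ/∂xᵢ` at `x`. -/
def partialDeriv {n : ℕ} (i : Fin n) (ψ : E n → ℝ) (x : E n) : ℝ :=
  fderiv ℝ ψ x (EuclideanSpace.single i 1)

/-- Scalar test functions, i.e. elements of `C_c^∞(ℝⁿ)`. -/
def IsTestFunction {n : ℕ} (ψ : E n → ℝ) : Prop :=
  ContDiff ℝ ((⊤ : ℕ∞) : WithTop ℕ∞) ψ ∧ HasCompactSupport ψ

/-- `div m = 0` on `ℝⁿ` in the sense of distributions. -/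
def WeakDivFree {n : ℕ} (m : E n → E n) : Prop :=
  ∀ ψ : E n → ℝ, IsTestFunction ψ → ∫ x, ∑ i, m x i * partialDeriv i ψ x = 0

/-- `div U + ∇P = B m` on `ℝⁿ` in the sense of distributions, where
`(div U)ᵢ = ∑ⱼ ∂ⱼ Uᵢⱼ`. -/
def WeakMomentum {n : ℕ} (B : Matrix (Fin n) (Fin n) ℝ) (m : E n → E n)
    (U : E n → SymTraceless n) (P : E n → ℝ) : Prop :=
  ∀ (i : Fin n) (ψ : E n → ℝ), IsTestFunction ψ →
    ∫ x, ((∑ j, (U x : Matrix (Fin n) (Fin n) ℝ) i j * partialDeriv j ψ x)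
      + P x * partialDeriv i ψ x + B.mulVec (m x).ofLp i * ψ x) = 0

/-- `(ρ, m, U, r)` is a subsolution on `ℝⁿ` of the steady compressible Euler equations with
pressure law `p` and source `B m`: a bounded measurable quadruple with `ρ > 0` that solves
`div m = 0`, `div U + ∇(p(ρ) + r) = B m` in the sense of distributions, with values `(m, U)(x)`
in the convex hull of `K_{ρ(x), r(x)}`. -/
structure IsSubsolution {n : ℕ} (p : ℝ → ℝ) (B : Matrix (Fin n) (Fin n) ℝ)
    (ρ : E n → ℝ) (m : E n → E n) (U : E n → SymTraceless n) (r : E n → ℝ) : Prop where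
  bdd_density : MemLp ρ ⊤ volume
  bdd_momentum : MemLp m ⊤ volume
  bdd_stress : ∀ i j, MemLp (fun x => (U x : Matrix (Fin n) (Fin n) ℝ) i j) ⊤ volume
  bdd_level : MemLp r ⊤ volume
  density_pos : ∀ᵐ x, 0 < ρ x
  div_free : WeakDivFree m
  momentum : WeakMomentum B m U (fun x => p (ρ x) + r x)
  mem_hull : ∀ᵐ x, (m x, U x) ∈ convexHull ℝ (constraintSet n (ρ x) (r x))

/-- The subsolution is strict in the open set `D`, with constraint sets `K_{ρ(x), r(x)}`: it is
continuous, and for `x ∈ D` one has `ρ(x) > 0`, `r(x) > 0` and `(m, U)(x)` lies in the interior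
(taken in `ℝⁿ` times the symmetric trace-free matrices) of the convex hull of `K_{ρ(x), r(x)}`.
These sets are compact and depend continuously on `x ∈ D` in the Hausdorff distance, because `ρ`
and `r` are continuous and positive on `D`. -/
structure IsStrictSubsolution {n : ℕ} (p : ℝ → ℝ) (B : Matrix (Fin n) (Fin n) ℝ)
    (ρ : E n → ℝ) (m : E n → E n) (U : E n → SymTraceless n) (r : E n → ℝ)
    (D : Set (E n)) : Prop extends IsSubsolution p B ρ m U r where
  isOpen_domain : IsOpen D
  continuous_density : Continuous ρ
  continuous_momentum : Continuous m
  continuous_stress : Continuous U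
  continuous_level : Continuous r
  density_pos_on : ∀ x ∈ D, 0 < ρ x
  level_pos_on : ∀ x ∈ D, 0 < r x
  mem_interior_hull : ∀ x ∈ D,
    (m x, U x) ∈ interior (convexHull ℝ (constraintSet n (ρ x) (r x)))

end SteadyEuler

end

/-! Put `P = p(ρ) - p(ρbar)`. It is `C¹`, supported in `closure Ω`, and the integral hypothesis says
that its mean is zero. The main task is to solve `div U + ∇P = a m` and `div m = 0` with compact
support in `Ω'`.

Fix a radial bump `ψ` of mass one and small support. Writing `P - ψ * P` as the integral of a
derivative along the segments from `x` to `x - z` gives a tensor `R` (`riesz`) whose trace is `P - ψ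
* P`. Since `ψ` is radial, `R` is symmetric, and then `div R = ∇(P - ψ * P)`. `R` only averages
translates of `∂P`, so it is continuous and its support grows by no more than the radius of `ψ`.

The remainder `ψ * P` is smooth and has mean zero. As `Ω'` is connected, it equals `div W` with `W`
smooth and compactly supported in `Ω'` (`exists_isDivergence_mollify`): its mass is transported
along segments and chains of balls to one point, where it cancels.

Now `S = 2R + ∇W + ∇Wᵀ - (2/n) P I` is symmetric and trace-free, and `div S = (2 - 2/n) ∇P + ΔW - ∇
div W`. With `c = n / (2(n - 1))`, the field `U = -c S` satisfies `div U + ∇P = c (∇ div W - ΔW)`.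
The right side is divergence-free, and since `a ≠ 0` it is `a m` for `m = (c/a) (∇ div W - ΔW)`
(`exists_compactly_supported_flux`).

Adding a constant to the pressure does not affect the equation. All fields are bounded and `ρ` is
bounded below, so a large constant gives the matrix inequality and the hull conditions. Any `(m, U)`
small relative to the level lies in the interior of the hull, by diagonalising `U`
(`mem_convexHull_constraintSet`). -/

open MeasureTheory

noncomputable section

namespace SteadyEuler

open scoped ContDiff Pointwise

variable {n : ℕ}

/-! ### Averages of translates -/

section TransAvg

variable {X : Type*} [MeasurableSpace X] {F : Type} [NormedAddCommGroup F] [NormedSpace ℝ F]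

/-- The average `∫ w(ξ) f(x - g(ξ)) dμ(ξ)` of the translates of `f` by `g(ξ)` with weight `w`. -/
def transAvg (μ : Measure X) (w : X → ℝ) (g : X → E n) (f : E n → F) (x : E n) : F :=
  ∫ ξ, w ξ • f (x - g ξ) ∂μ

variable {μ : Measure X} {w : X → ℝ} {g : X → E n} {f : E n → F}

theorem aestronglyMeasurable_transAvg (hw : Integrable w μ) (hg : Measurable g)
    (hf : Continuous f) (x : E n) :
    AEStronglyMeasurable (fun ξ => w ξ • f (x - g ξ)) μ :=
  hw.1.smul (hf.comp_aestronglyMeasurable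
    (measurable_const.sub hg).aestronglyMeasurable)

theorem integrable_transAvg (hw : Integrable w μ) (hg : Measurable g)
    (hf : Continuous f) (hfc : HasCompactSupport f) (x : E n) :
    Integrable (fun ξ => w ξ • f (x - g ξ)) μ := by
  obtain ⟨C, hC⟩ := hfc.exists_bound_of_continuous hf
  refine (hw.norm.mul_const C).mono' (aestronglyMeasurable_transAvg hw hg hf x) ?_
  filter_upwards with ξ
  rw [norm_smul]
  gcongr
  exact hC _

theorem continuous_transAvg (hw : Integrable w μ) (hg : Measurable g)
    (hf : Continuous f) (hfc : HasCompactSupport f) : Continuous (transAvg μ w g f) := by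
  obtain ⟨C, hC⟩ := hfc.exists_bound_of_continuous hf
  refine continuous_of_dominated (bound := fun ξ => ‖w ξ‖ * C)
    (aestronglyMeasurable_transAvg hw hg hf) (fun x => ?_) (hw.norm.mul_const C) ?_
  · filter_upwards with ξ
    rw [norm_smul]
    gcongr
    exact hC _
  · filter_upwards with ξ
    fun_prop

theorem hasFDerivAt_transAvg (hw : Integrable w μ) (hg : Measurable g)
    (hf : ContDiff ℝ 1 f) (hfc : HasCompactSupport f) (x : E n) :
    HasFDerivAt (transAvg μ w g f) (transAvg μ w g (fderiv ℝ f) x) x := by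
  have hf' : Continuous (fderiv ℝ f) := hf.continuous_fderiv one_ne_zero
  obtain ⟨C, hC⟩ := (hfc.fderiv ℝ).exists_bound_of_continuous hf'
  refine hasFDerivAt_integral_of_dominated_of_fderiv_le (bound := fun ξ => ‖w ξ‖ * C)
    (F' := fun x ξ => w ξ • fderiv ℝ f (x - g ξ))
    Filter.univ_mem (Filter.Eventually.of_forall
      (aestronglyMeasurable_transAvg hw hg hf.continuous))
    (integrable_transAvg hw hg hf.continuous hfc x)
    (aestronglyMeasurable_transAvg hw hg hf' x) ?_ (hw.norm.mul_const C) ?_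
  · filter_upwards with ξ y _
    rw [norm_smul]
    gcongr
    exact hC _
  · filter_upwards with ξ y _
    have h := ((hf.differentiable one_ne_zero) (y - g ξ)).hasFDerivAt
    exact ((hasFDerivAt_comp_sub (g ξ)).2 h).const_smul (w ξ)

theorem contDiff_nat_transAvg (hw : Integrable w μ) (hg : Measurable g) (k : ℕ) :
    -- The target space is quantified inside the induction because the derivative takes values in a
    -- space of linear maps.
    ∀ {F : Type} [NormedAddCommGroup F] [NormedSpace ℝ F] {f : E n → F}, ContDiff ℝ k f →
      HasCompactSupport f → ContDiff ℝ k (transAvg μ w g f) := by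
  induction k with
  | zero =>
    intro F _ _ f hf hfc
    exact contDiff_zero.2 (continuous_transAvg hw hg hf.continuous hfc)
  | succ k ih =>
    intro F _ _ f hf hfc
    have h1 : ContDiff ℝ 1 f := hf.of_le (by exact_mod_cast Nat.le_add_left 1 k)
    refine contDiff_succ_iff_hasFDerivAt.2 ⟨transAvg μ w g (fderiv ℝ f), ?_,
      hasFDerivAt_transAvg hw hg h1 hfc⟩
    exact ih (hf.fderiv_right (by norm_cast)) (hfc.fderiv ℝ)

theorem contDiff_transAvg (hw : Integrable w μ) (hg : Measurable g)
    (hf : ContDiff ℝ ∞ f) (hfc : HasCompactSupport f) : ContDiff ℝ ∞ (transAvg μ w g f) :=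
  contDiff_infty.2 fun k => contDiff_nat_transAvg hw hg k (contDiff_infty.1 hf k) hfc

theorem partialDeriv_transAvg {f : E n → ℝ} (hw : Integrable w μ) (hg : Measurable g)
    (hf : ContDiff ℝ 1 f) (hfc : HasCompactSupport f) (i : Fin n) (x : E n) :
    partialDeriv i (transAvg μ w g f) x = transAvg μ w g (partialDeriv i f) x := by
  rw [partialDeriv, (hasFDerivAt_transAvg hw hg hf hfc x).fderiv, transAvg,
    ContinuousLinearMap.integral_apply (integrable_transAvg hw hg
      (hf.continuous_fderiv one_ne_zero) (hfc.fderiv ℝ) x)]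
  rfl

theorem tsupport_transAvg_subset {G : Set (E n)} (hG : IsCompact G)
    (hwG : ∀ᵐ ξ ∂μ, w ξ ≠ 0 → g ξ ∈ G) (hfc : HasCompactSupport f) :
    tsupport (transAvg μ w g f) ⊆ tsupport f + G := by
  refine closure_minimal (fun x hx => ?_) (hfc.isCompact.add hG).isClosed
  by_contra hx'
  refine hx (integral_eq_zero_of_ae ?_)
  filter_upwards [hwG] with ξ hξ
  by_cases h0 : w ξ = 0
  · simp [h0]
  · have : x - g ξ ∉ tsupport f := fun hmem =>
      hx' ⟨x - g ξ, hmem, g ξ, hξ h0, by simp⟩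
    simp [image_eq_zero_of_notMem_tsupport this]

theorem hasCompactSupport_transAvg {G : Set (E n)} (hG : IsCompact G)
    (hwG : ∀ᵐ ξ ∂μ, w ξ ≠ 0 → g ξ ∈ G) (hfc : HasCompactSupport f) :
    HasCompactSupport (transAvg μ w g f) :=
  (hfc.isCompact.add hG).of_isClosed_subset (isClosed_tsupport _)
    (tsupport_transAvg_subset hG hwG hfc)

end TransAvg

/-! ### Partial derivatives -/

theorem partialDeriv_continuous {f : E n → ℝ} (hf : ContDiff ℝ 1 f) (i : Fin n) :
    Continuous (partialDeriv i f) :=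
  (hf.continuous_fderiv one_ne_zero).clm_apply continuous_const

theorem partialDeriv_contDiff {f : E n → ℝ} {k l : ℕ∞ω} (hf : ContDiff ℝ l f) (hkl : k + 1 ≤ l)
    (i : Fin n) : ContDiff ℝ k (partialDeriv i f) :=
  (hf.fderiv_right hkl).clm_apply contDiff_const

theorem tsupport_partialDeriv_subset (f : E n → ℝ) (i : Fin n) :
    tsupport (partialDeriv i f) ⊆ tsupport f :=
  tsupport_fderiv_apply_subset ℝ _

theorem HasCompactSupport.partialDeriv {f : E n → ℝ} (hf : HasCompactSupport f) (i : Fin n) :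
    HasCompactSupport (partialDeriv i f) :=
  hf.fderiv_apply ℝ _

theorem fderiv_eq_sum_partialDeriv (f : E n → ℝ) (x v : E n) :
    fderiv ℝ f x v = ∑ i, v i * partialDeriv i f x := by
  have hv : v = ∑ i, v i • EuclideanSpace.single i (1 : ℝ) := by
    simpa using ((EuclideanSpace.basisFun (Fin n) ℝ).sum_repr v).symm
  conv_lhs => rw [hv, map_sum]
  simp [partialDeriv]

/-! ### Transport along segments -/

section Transport

variable {ν : Measure (E n)} {k : E n → ℝ} {c : E n} {r : ℝ}

/-- The measure `dt ⊗ ν` on `[0,1] × ℝⁿ`. -/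
def segMeasure (ν : Measure (E n)) : Measure (ℝ × E n) :=
  (volume.restrict (Set.Icc (0 : ℝ) 1)).prod ν

/-- The point `c + t (y - c)`. -/
def segPoint (c : E n) (ξ : ℝ × E n) : E n := c + ξ.1 • (ξ.2 - c)

/-- The weight `k(y) (y - c)ᵢ`. -/
def segWeight (k : E n → ℝ) (c : E n) (i : Fin n) (ξ : ℝ × E n) : ℝ := k ξ.2 * (ξ.2 - c) i

theorem measurable_segPoint : Measurable (segPoint c) := by
  unfold segPoint
  exact Continuous.measurable (by fun_prop)

theorem integrable_segWeight [SFinite ν] (hk : Integrable k ν)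
    (hkc : ∀ y, k y ≠ 0 → y ∈ Metric.closedBall c r) (i : Fin n) :
    Integrable (segWeight k c i) (segMeasure ν) := by
  have h1 : Integrable (fun y => k y * (y - c) i) ν := by
    refine (hk.norm.mul_const r).mono' (hk.1.mul ?_) ?_
    · exact (Continuous.aestronglyMeasurable (by fun_prop))
    · filter_upwards with y
      by_cases h0 : k y = 0
      · simp [h0]
      · rw [norm_mul]
        gcongr
        calc ‖(y - c) i‖ ≤ ‖y - c‖ := PiLp.norm_apply_le _ _
          _ ≤ r := by simpa [dist_eq_norm] using hkc y h0
  exact h1.comp_snd _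

theorem segPoint_mem (hkc : ∀ y, k y ≠ 0 → y ∈ Metric.closedBall c r) (i : Fin n) :
    ∀ᵐ ξ ∂(segMeasure ν), segWeight k c i ξ ≠ 0 → segPoint c ξ ∈ Metric.closedBall c r := by
  have h1 : ∀ᵐ ξ ∂(segMeasure ν), ξ.1 ∈ Set.Icc (0 : ℝ) 1 :=
    Measure.quasiMeasurePreserving_fst.ae (ae_restrict_mem measurableSet_Icc)
  filter_upwards [h1] with ξ hξ h0
  have hy := hkc ξ.2 (left_ne_zero_of_mul h0)
  have := (convex_closedBall c r).add_smul_sub_mem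
    (Metric.mem_closedBall_self (dist_nonneg.trans hy)) hy hξ
  simpa [segPoint] using this

/-- Fundamental theorem of calculus for `f` along the segment from `x - c` to `x - y`, integrated
against `k`. It is used in two ways: to transport mass towards `c`, and, with `c = 0` and `k = ψ`,
to compute the trace of `riesz`. -/
theorem sum_transAvg_segWeight [SFinite ν] (hk : Integrable k ν)
    (hkc : ∀ y, k y ≠ 0 → y ∈ Metric.closedBall c r) {f : E n → ℝ}
    (hf : ContDiff ℝ 1 f) (hfc : HasCompactSupport f) (x : E n) :
    ∑ i, transAvg (segMeasure ν) (segWeight k c i) (segPoint c) (partialDeriv i f) x =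
      (∫ y, k y ∂ν) * f (x - c) - ∫ y, k y * f (x - y) ∂ν := by
  have hint : ∀ i, Integrable
      (fun ξ => segWeight k c i ξ • partialDeriv i f (x - segPoint c ξ)) (segMeasure ν) :=
    fun i => integrable_transAvg (integrable_segWeight hk hkc i) measurable_segPoint
      (partialDeriv_continuous hf i) (HasCompactSupport.partialDeriv hfc i) x
  have hint' := integrable_finsetSum Finset.univ fun i _ => hint i
  unfold transAvg
  rw [← integral_finsetSum _ fun i _ => hint i, segMeasure, integral_prod_symm _ hint']
  have hd : ∀ y, ∫ t in Set.Icc (0 : ℝ) 1, ∑ i, segWeight k c i (t, y) •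
      partialDeriv i f (x - segPoint c (t, y)) = k y * (f (x - c) - f (x - y)) := by
    intro y
    have h1 : ∀ t : ℝ, HasDerivAt (fun t => - (k y * f (x - segPoint c (t, y))))
        (∑ i, segWeight k c i (t, y) • partialDeriv i f (x - segPoint c (t, y))) t := by
      intro t
      have h2 : HasDerivAt (fun t => x - segPoint c (t, y)) (-(y - c)) t := by
        have := (((hasDerivAt_id t).smul_const (y - c)).const_add c).const_sub x
        simpa [segPoint] using this
      have h3 := ((hf.differentiable one_ne_zero
        (x - segPoint c (t, y))).hasFDerivAt.comp_hasDerivAt t h2)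
      have h4 := (h3.const_mul (k y)).neg
      refine h4.congr_deriv ?_
      rw [map_neg, fderiv_eq_sum_partialDeriv]
      simp [segWeight, Finset.mul_sum, mul_assoc]
    rw [integral_Icc_eq_integral_Ioc, ← intervalIntegral.integral_of_le zero_le_one,
      intervalIntegral.integral_eq_sub_of_hasDerivAt (fun t _ => h1 t)]
    · simp [segPoint]; ring
    · refine Continuous.intervalIntegrable ?_ _ _
      refine continuous_finsetSum _ fun i _ => ?_
      have := partialDeriv_continuous hf i
      simp only [segWeight, segPoint]
      fun_prop
  simp_rw [hd, mul_sub]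
  rw [integral_sub (hk.mul_const _), integral_mul_const]
  exact integrable_transAvg hk measurable_id hf.continuous hfc x

end Transport

/-! ### Divergences of compactly supported smooth fields -/

/-- `f = div W` for a smooth field `W` with compact support in `D`. -/
def IsDivergence (D : Set (E n)) (f : E n → ℝ) : Prop :=
  ∃ W : Fin n → E n → ℝ, (∀ i, ContDiff ℝ ∞ (W i)) ∧ (∀ i, HasCompactSupport (W i)) ∧
    (∀ i, tsupport (W i) ⊆ D) ∧ ∀ x, f x = ∑ i, partialDeriv i (W i) x

variable {D : Set (E n)}

theorem partialDeriv_add {f g : E n → ℝ} (hf : Differentiable ℝ f) (hg : Differentiable ℝ g)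
    (i : Fin n) (x : E n) :
    partialDeriv i (f + g) x = partialDeriv i f x + partialDeriv i g x := by
  simp [partialDeriv, fderiv_add (hf x) (hg x)]

theorem partialDeriv_const_smul {f : E n → ℝ} (hf : Differentiable ℝ f)
    (a : ℝ) (i : Fin n) (x : E n) :
    partialDeriv i (a • f) x = a * partialDeriv i f x := by
  simp [partialDeriv, fderiv_const_smul (hf x)]

theorem IsDivergence.zero : IsDivergence D (0 : E n → ℝ) := by
  refine ⟨0, fun i => contDiff_const, fun i => HasCompactSupport.zero, fun i => ?_, fun x => ?_⟩
  · simp [tsupport]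
  · simp [partialDeriv]

theorem IsDivergence.add {f g : E n → ℝ} (hf : IsDivergence D f) (hg : IsDivergence D g) :
    IsDivergence D (f + g) := by
  obtain ⟨V, hV, hVc, hVs, hVd⟩ := hf
  obtain ⟨W, hW, hWc, hWs, hWd⟩ := hg
  refine ⟨fun i => V i + W i, fun i => (hV i).add (hW i), fun i => (hVc i).add (hWc i),
    fun i => (tsupport_add _ _).trans (Set.union_subset (hVs i) (hWs i)), fun x => ?_⟩
  simp only [Pi.add_apply, hVd, hWd, ← Finset.sum_add_distrib]
  refine Finset.sum_congr rfl fun i _ => (partialDeriv_add ?_ ?_ i x).symm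
  · exact (hV i).differentiable (by simp)
  · exact (hW i).differentiable (by simp)

theorem IsDivergence.const_smul {f : E n → ℝ} (hf : IsDivergence D f) (a : ℝ) :
    IsDivergence D (a • f) := by
  obtain ⟨V, hV, hVc, hVs, hVd⟩ := hf
  refine ⟨fun i => a • V i, fun i => (hV i).const_smul a,
    fun i => (hVc i).smul_left (f := fun _ => a),
    fun i => (tsupport_smul_subset_right (fun _ => a) (V i)).trans (hVs i), fun x => ?_⟩
  simp only [Pi.smul_apply, hVd, smul_eq_mul, Finset.mul_sum]
  exact Finset.sum_congr rfl fun i _ =>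
    (partialDeriv_const_smul ((hV i).differentiable (by simp)) a i x).symm

theorem IsDivergence.neg {f : E n → ℝ} (hf : IsDivergence D f) : IsDivergence D (-f) := by
  simpa using hf.const_smul (-1)

/-- A smooth function supported in the closed ball of radius `ε` around `0`. -/
structure IsBump (ε : ℝ) (ψ : E n → ℝ) : Prop where
  smooth : ContDiff ℝ ∞ ψ
  compact : HasCompactSupport ψ
  supp : tsupport ψ ⊆ Metric.closedBall 0 ε

theorem IsBump.mono {ε δ : ℝ} {ψ : E n → ℝ} (h : IsBump ε ψ) (hεδ : ε ≤ δ) : IsBump δ ψ :=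
  ⟨h.smooth, h.compact, h.supp.trans (Metric.closedBall_subset_closedBall hεδ)⟩

/-- The derivative in the segment formula can be moved outside the average, so mass spread over a
ball is moved to its centre by a field that stays within `ε` of that ball. -/
theorem IsBump.isDivergence {ν : Measure (E n)} [SFinite ν] {k : E n → ℝ} {c : E n} {r ε : ℝ}
    {ψ : E n → ℝ} (hψ : IsBump ε ψ) (hk : Integrable k ν)
    (hkc : ∀ y, k y ≠ 0 → y ∈ Metric.closedBall c r) (hD : Metric.closedBall c (r + ε) ⊆ D) :
    IsDivergence D (fun x => (∫ y, k y ∂ν) * ψ (x - c) - ∫ y, k y * ψ (x - y) ∂ν) := by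
  have hG := isCompact_closedBall c r
  refine ⟨fun i => transAvg (segMeasure ν) (segWeight k c i) (segPoint c) ψ,
    fun i => contDiff_transAvg (integrable_segWeight hk hkc i) measurable_segPoint hψ.1 hψ.2,
    fun i => hasCompactSupport_transAvg hG (segPoint_mem hkc i) hψ.2, fun i => ?_, fun x => ?_⟩
  · refine (tsupport_transAvg_subset hG (segPoint_mem hkc i) hψ.2).trans
      (Set.Subset.trans ?_ hD)
    rintro _ ⟨u, hu, v, hv, rfl⟩
    have hu' := hψ.supp hu
    simp only [Metric.mem_closedBall, dist_eq_norm, sub_zero] at *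
    calc ‖u + v - c‖ = ‖(v - c) + u‖ := by congr 1; abel
      _ ≤ r + ε := (norm_add_le _ _).trans (add_le_add hv hu')
  · beta_reduce
    rw [← sum_transAvg_segWeight hk hkc (hψ.1.of_le (by simp)) hψ.2]
    exact Finset.sum_congr rfl fun i _ =>
      (partialDeriv_transAvg (integrable_segWeight hk hkc i) measurable_segPoint
        (hψ.1.of_le (by simp)) hψ.2 i x).symm

/-- The relation between `x` and `y` is symmetric, transitive and holds for nearby points, hence for
all pairs in a preconnected set. -/
theorem exists_isDivergence_points (hD : IsOpen D) (hDc : IsPreconnected D) {x y : E n}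
    (hx : x ∈ D) (hy : y ∈ D) :
    ∃ ε > 0, ∀ ψ : E n → ℝ, IsBump ε ψ → IsDivergence D (fun z => ψ (z - x) - ψ (z - y)) := by
  refine hDc.induction₂ (fun x y => ∃ ε > 0, ∀ ψ : E n → ℝ, IsBump ε ψ →
    IsDivergence D (fun z => ψ (z - x) - ψ (z - y))) ?_ ?_ ?_ hx hy
  · intro x hx
    obtain ⟨r, hr, hrD⟩ := Metric.nhds_basis_closedBall.mem_iff.1 (hD.mem_nhds hx)
    filter_upwards [mem_nhdsWithin_of_mem_nhds (Metric.closedBall_mem_nhds x (half_pos hr))]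
      with y hy
    refine ⟨r / 2, half_pos hr, fun ψ hψ => ?_⟩
    -- A unit point mass at `y` is moved to `x`.
    have h := hψ.isDivergence (D := D) (ν := Measure.dirac y) (c := x) (r := r / 2)
      (k := Set.indicator {y} 1) ?_ ?_ (by rwa [add_halves])
    · simpa [integral_dirac] using h
    · exact (integrable_const (1 : ℝ)).indicator (measurableSet_singleton y)
    · intro z hz
      have : z = y := by simpa using Set.mem_of_indicator_ne_zero hz
      rwa [this]
  · rintro x y z - - - ⟨ε, hε, h⟩ ⟨δ, hδ, h'⟩
    refine ⟨min ε δ, lt_min hε hδ, fun ψ hψ => ?_⟩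
    convert (h ψ (hψ.mono (min_le_left _ _))).add (h' ψ (hψ.mono (min_le_right _ _))) using 1
    ext w
    simp
  · rintro x y - - ⟨ε, hε, h⟩
    refine ⟨ε, hε, fun ψ hψ => ?_⟩
    convert (h ψ hψ).neg using 1
    ext w
    simp

theorem integrable_mul_translate {k ψ : E n → ℝ} (hk : Integrable k) (hψ : Continuous ψ)
    (hψc : HasCompactSupport ψ) (x : E n) : Integrable fun y => k y * ψ (x - y) :=
  integrable_transAvg hk measurable_id hψ hψc x

/-- All mass in `K` is collected at `y₀`. The radius `ε` depends neither on `ψ` nor on `k`, so the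
bump may be chosen afterwards. -/
theorem exists_isDivergence_compact (hD : IsOpen D) (hDc : IsPreconnected D) {K : Set (E n)}
    (hK : IsCompact K) (hKD : K ⊆ D) {y₀ : E n} (hy₀ : y₀ ∈ D) :
    ∃ ε > 0, ∀ ψ : E n → ℝ, IsBump ε ψ → ∀ k : E n → ℝ, Integrable k → (∀ y ∉ K, k y = 0) →
      IsDivergence D (fun x => (∫ y, k y) * ψ (x - y₀) - ∫ y, k y * ψ (x - y)) := by
  -- A measurable superset of `K` is carried along so that, for a union, `k` can be split by an
  -- indicator function.
  suffices h : ∃ s, K ⊆ s ∧ MeasurableSet s ∧ ∃ ε > 0, ∀ ψ : E n → ℝ, IsBump ε ψ →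
      ∀ k : E n → ℝ, Integrable k → (∀ y ∉ s, k y = 0) →
      IsDivergence D (fun x => (∫ y, k y) * ψ (x - y₀) - ∫ y, k y * ψ (x - y)) by
    obtain ⟨s, hKs, -, ε, hε, h⟩ := h
    exact ⟨ε, hε, fun ψ hψ k hk hkK => h ψ hψ k hk fun y hy => hkK y fun hy' => hy (hKs hy')⟩
  refine hK.induction_on (p := fun K => ∃ s, K ⊆ s ∧ MeasurableSet s ∧ ∃ ε > 0,
      ∀ ψ : E n → ℝ, IsBump ε ψ → ∀ k : E n → ℝ, Integrable k → (∀ y ∉ s, k y = 0) →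
      IsDivergence D (fun x => (∫ y, k y) * ψ (x - y₀) - ∫ y, k y * ψ (x - y))) ?_ ?_ ?_ ?_
  · refine ⟨∅, subset_rfl, MeasurableSet.empty, 1, one_pos, fun ψ _ k _ hk => ?_⟩
    have : k = 0 := funext fun y => hk y (by simp)
    simpa [this] using! (IsDivergence.zero (D := D))
  · rintro K L hKL ⟨s, hs, h⟩
    exact ⟨s, hKL.trans hs, h⟩
  · rintro K L ⟨s, hs, hsm, ε, hε, h⟩ ⟨t, ht, htm, δ, hδ, h'⟩
    refine ⟨s ∪ t, Set.union_subset_union hs ht, hsm.union htm, min ε δ, lt_min hε hδ,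
      fun ψ hψ k hk hkst => ?_⟩
    have hk1 : Integrable (s.indicator k) := hk.indicator hsm
    have hk2 : Integrable (sᶜ.indicator k) := hk.indicator hsm.compl
    have e : ∀ y, k y = s.indicator k y + sᶜ.indicator k y := fun y =>
      (congrFun (Set.indicator_self_add_compl s k) y).symm
    convert (h ψ (hψ.mono (min_le_left _ _)) _ hk1 fun y hy => Set.indicator_of_notMem hy k).add
      (h' ψ (hψ.mono (min_le_right _ _)) _ hk2 fun y hy => ?_) using 1
    · ext x
      have e1 : ∫ y, k y = (∫ y, s.indicator k y) + ∫ y, sᶜ.indicator k y := by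
        rw [← integral_add hk1 hk2]; exact integral_congr_ae (.of_forall e)
      have e2 : ∫ y, k y * ψ (x - y) = (∫ y, s.indicator k y * ψ (x - y)) +
          ∫ y, sᶜ.indicator k y * ψ (x - y) := by
        rw [← integral_add (integrable_mul_translate hk1 hψ.1.continuous hψ.2 x)
          (integrable_mul_translate hk2 hψ.1.continuous hψ.2 x)]
        exact integral_congr_ae (.of_forall fun y => by simp only [e y]; ring)
      rw [e1, e2, Pi.add_apply]
      ring
    · by_cases hys : y ∈ s
      · simp [hys]
      · simp [hys, hkst y (by simp [hys, hy])]
  · intro c hc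
    obtain ⟨r, hr, hrD⟩ := Metric.nhds_basis_closedBall.mem_iff.1 (hD.mem_nhds (hKD hc))
    obtain ⟨ε, hε, h⟩ := exists_isDivergence_points hD hDc hy₀ (hKD hc)
    refine ⟨Metric.closedBall c (r / 2),
      mem_nhdsWithin_of_mem_nhds (Metric.closedBall_mem_nhds c (half_pos hr)),
      _, subset_rfl, Metric.isClosed_closedBall.measurableSet, min ε (r / 2),
      lt_min hε (half_pos hr), fun ψ hψ k hk hkc => ?_⟩
    -- The mass near `c` goes first to `c` and then from `c` to `y₀`.
    convert ((h ψ (hψ.mono (min_le_left _ _))).const_smul (∫ y, k y)).add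
      ((hψ.mono (min_le_right _ _)).isDivergence hk (c := c) (r := r / 2)
        (fun y hy => by_contra fun hy' => hy (hkc y hy')) (by rwa [add_halves])) using 1
    ext x
    simp only [Pi.add_apply, Pi.smul_apply, smul_eq_mul]
    ring

/-! ### Integration by parts -/

theorem integral_mul_partialDeriv {f g : E n → ℝ} (hf : ContDiff ℝ 1 f) (hg : ContDiff ℝ 1 g)
    (hgc : HasCompactSupport g) (i : Fin n) :
    ∫ x, f x * partialDeriv i g x = - ∫ x, partialDeriv i f x * g x := by
  have hf' := partialDeriv_continuous hf i
  have hg' := partialDeriv_continuous hg i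
  refine integral_mul_fderiv_eq_neg_fderiv_mul_of_integrable ?_ ?_ ?_
    (fun x _ => hf.differentiable one_ne_zero x) (fun x _ => hg.differentiable one_ne_zero x)
  · exact (hf'.mul hg.continuous).integrable_of_hasCompactSupport hgc.mul_left
  · exact (hf.continuous.mul hg').integrable_of_hasCompactSupport
      (HasCompactSupport.partialDeriv hgc i).mul_left
  · exact (hf.continuous.mul hg.continuous).integrable_of_hasCompactSupport hgc.mul_left

theorem partialDeriv_comm {f : E n → ℝ} (hf : ContDiff ℝ 2 f) (i j : Fin n) (x : E n) :
    partialDeriv i (partialDeriv j f) x = partialDeriv j (partialDeriv i f) x := by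
  have hd : DifferentiableAt ℝ (fderiv ℝ f) x :=
    (hf.fderiv_right (m := 1) (by norm_num)).differentiable one_ne_zero x
  have key : ∀ i j : Fin n, partialDeriv i (partialDeriv j f) x =
      fderiv ℝ (fderiv ℝ f) x (EuclideanSpace.single i 1) (EuclideanSpace.single j 1) := by
    intro i j
    have h := (hd.hasFDerivAt.clm_apply
      (hasFDerivAt_const (EuclideanSpace.single j (1 : ℝ)) x)).fderiv
    have h' : fderiv ℝ (partialDeriv j f) x = _ := h
    rw [partialDeriv, h']
    simp
  rw [key, key]
  exact (hf.contDiffAt.isSymmSndFDerivAt (by simp)).eq _ _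

theorem integral_partialDeriv_mul_partialDeriv_comm {f χ : E n → ℝ} (hf : ContDiff ℝ 1 f)
    (hχ : ContDiff ℝ 2 χ) (hχc : HasCompactSupport χ) (i j : Fin n) :
    ∫ x, partialDeriv i f x * partialDeriv j χ x =
      ∫ x, partialDeriv j f x * partialDeriv i χ x := by
  have h : ∀ i j : Fin n, ∫ x, partialDeriv i f x * partialDeriv j χ x =
      - ∫ x, f x * partialDeriv i (partialDeriv j χ) x := fun i j => by
    rw [integral_mul_partialDeriv hf (partialDeriv_contDiff hχ (by norm_num) j)
      (HasCompactSupport.partialDeriv hχc j), neg_neg]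
  rw [h i j, h j i]
  simp_rw [partialDeriv_comm hχ i j]

theorem partialDeriv_comp_sub (f : E n → ℝ) (i : Fin n) (v x : E n) :
    partialDeriv i (fun y => f (y - v)) x = partialDeriv i f (x - v) := by
  simp [partialDeriv, fderiv_comp_sub]

theorem integral_transAvg_mul {X : Type*} [MeasurableSpace X] {μ : Measure X} [SFinite μ]
    {w : X → ℝ} {g : X → E n}
    (hw : Integrable w μ) (hg : Measurable g) {f χ : E n → ℝ} (hf : Continuous f)
    (hfc : HasCompactSupport f) (hχ : Continuous χ) (hχc : HasCompactSupport χ) :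
    ∫ x, transAvg μ w g f x * χ x = ∫ ξ, w ξ * ∫ x, f (x - g ξ) * χ x ∂volume ∂μ := by
  obtain ⟨C, hC⟩ := hfc.exists_bound_of_continuous hf
  have hi : Integrable (fun z : E n × X => w z.2 * f (z.1 - g z.2) * χ z.1)
      (volume.prod μ) := by
    have hχi : Integrable χ volume := hχ.integrable_of_hasCompactSupport hχc
    have h1 : Integrable (fun z : E n × X => χ z.1 * w z.2) (volume.prod μ) := hχi.mul_prod hw
    refine (h1.norm.mul_const C).mono' ?_ ?_
    · refine (hw.1.comp_snd.mul ?_).mul hχ.aestronglyMeasurable.comp_fst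
      exact (hf.measurable.comp
        (measurable_fst.sub (hg.comp measurable_snd))).aestronglyMeasurable
    · filter_upwards with z
      rw [norm_mul, norm_mul, norm_mul]
      calc ‖w z.2‖ * ‖f (z.1 - g z.2)‖ * ‖χ z.1‖ ≤ ‖w z.2‖ * C * ‖χ z.1‖ := by
            gcongr; exact hC _
        _ = _ := by ring
  simp_rw [← integral_const_mul, transAvg, ← integral_mul_const, smul_eq_mul, ← mul_assoc]
  exact integral_integral_swap hi

/-! ### The truncated double Riesz transform -/

section Riesz

variable {ε : ℝ} {ψ f : E n → ℝ}

/-- The truncated double Riesz transform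
`∫₀¹ ∫ zᵢ ψ(z) ∂ⱼf(x - t z) dz dt`. -/
def riesz (ψ f : E n → ℝ) (i j : Fin n) : E n → ℝ :=
  transAvg (segMeasure volume) (segWeight ψ 0 i) (segPoint 0) (partialDeriv j f)

/-- The convolution `∫ ψ(z) f(x - z) dz`. -/
def mollify (ψ f : E n → ℝ) (x : E n) : ℝ := ∫ z, ψ z * f (x - z)

theorem IsBump.mem_closedBall (hψ : IsBump ε ψ) (y : E n) (hy : ψ y ≠ 0) :
    y ∈ Metric.closedBall 0 ε := hψ.supp (subset_tsupport _ hy)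

theorem IsBump.integrable (hψ : IsBump ε ψ) : Integrable ψ :=
  hψ.smooth.continuous.integrable_of_hasCompactSupport hψ.compact

theorem IsBump.integrable_segWeight (hψ : IsBump ε ψ) (i : Fin n) :
    Integrable (segWeight ψ 0 i) (segMeasure volume) :=
  SteadyEuler.integrable_segWeight hψ.integrable hψ.mem_closedBall i

theorem continuous_riesz (hψ : IsBump ε ψ) (hf : ContDiff ℝ 1 f) (hfc : HasCompactSupport f)
    (i j : Fin n) : Continuous (riesz ψ f i j) :=
  continuous_transAvg (hψ.integrable_segWeight i) measurable_segPoint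
    (partialDeriv_continuous hf j) (HasCompactSupport.partialDeriv hfc j)

theorem tsupport_riesz_subset (hψ : IsBump ε ψ) (hfc : HasCompactSupport f) (i j : Fin n) :
    tsupport (riesz ψ f i j) ⊆ tsupport f + Metric.closedBall 0 ε :=
  (tsupport_transAvg_subset (isCompact_closedBall 0 ε) (segPoint_mem hψ.mem_closedBall i)
    (HasCompactSupport.partialDeriv hfc j)).trans
    (Set.add_subset_add_right (tsupport_partialDeriv_subset f j))

theorem sum_riesz (hψ : IsBump ε ψ) (hψ1 : ∫ z, ψ z = 1) (hf : ContDiff ℝ 1 f)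
    (hfc : HasCompactSupport f) (x : E n) :
    ∑ i, riesz ψ f i i x = f x - mollify ψ f x := by
  have := sum_transAvg_segWeight hψ.integrable hψ.mem_closedBall hf hfc x
  simpa [hψ1] using! this

/-- For fixed `t`, integration by parts in `z` turns `t ∫ zᵢ ψ ∂ⱼf(x - tz)` into `∫ (δᵢⱼ ψ + zᵢ ∂ⱼψ)
f(x - tz)`. This is symmetric in `i, j` because `ψ` is radial; dividing by `t` is allowed for almost
every `t`. -/
theorem riesz_comm (hψ : IsBump ε ψ)
    (hrad : ∀ (i j : Fin n) (z : E n), z i * partialDeriv j ψ z = z j * partialDeriv i ψ z)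
    (hf : ContDiff ℝ 1 f) (hfc : HasCompactSupport f) (i j : Fin n) (x : E n) :
    riesz ψ f i j x = riesz ψ f j i x := by
  have hint : ∀ i j, Integrable
      (fun ξ => segWeight ψ 0 i ξ • partialDeriv j f (x - segPoint 0 ξ))
      (segMeasure volume) := fun i j =>
    integrable_transAvg (hψ.integrable_segWeight i) measurable_segPoint
      (partialDeriv_continuous hf j) (HasCompactSupport.partialDeriv hfc j) x
  simp only [riesz, transAvg]
  unfold segMeasure at hint ⊢
  rw [integral_prod _ (hint i j), integral_prod _ (hint j i)]
  refine integral_congr_ae ?_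
  have h0 : ∀ᵐ t : ℝ ∂(volume.restrict (Set.Icc (0 : ℝ) 1)), t ≠ 0 :=
    Measure.ae_ne _ 0
  filter_upwards [h0] with t ht
  have hψ1 : ContDiff ℝ 1 ψ := hψ.smooth.of_le (by simp)
  have hcoord : ∀ i : Fin n, ContDiff ℝ 1 (fun z : E n => z i) := fun i => by fun_prop
  have hw : ∀ i : Fin n, ContDiff ℝ 1 (fun z => z i * ψ z) := fun i => (hcoord i).mul hψ1
  have hF : ContDiff ℝ 1 (fun z => f (x - t • z)) := by fun_prop
  have hdF : ∀ (j : Fin n) z, partialDeriv j (fun z => f (x - t • z)) z =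
      -t * partialDeriv j f (x - t • z) := by
    intro j z
    have h1 : HasFDerivAt (fun z : E n => x - t • z) (-(t • ContinuousLinearMap.id ℝ (E n))) z :=
      ((hasFDerivAt_id z).const_smul t).const_sub x
    have h2 := ((hf.differentiable one_ne_zero (x - t • z)).hasFDerivAt.comp z h1).fderiv
    have h3 : fderiv ℝ (fun z => f (x - t • z)) z = _ := h2
    rw [partialDeriv, h3]
    simp [partialDeriv]
  have hdw : ∀ (i j : Fin n) z, partialDeriv j (fun z => z i * ψ z) z =
      (if i = j then 1 else 0) * ψ z + z i * partialDeriv j ψ z := by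
    intro i j z
    have h1 : HasFDerivAt (fun z : E n => z i) (EuclideanSpace.proj i : E n →L[ℝ] ℝ) z :=
      (EuclideanSpace.proj i : E n →L[ℝ] ℝ).hasFDerivAt
    have h2 := (h1.mul (hψ1.differentiable one_ne_zero z).hasFDerivAt).fderiv
    have h3 : fderiv ℝ (fun z => z i * ψ z) z = _ := h2
    rw [partialDeriv, h3]
    simp [partialDeriv]
    ring
  have hparts : ∀ i j : Fin n, t * ∫ z, z i * ψ z * partialDeriv j f (x - t • z) =
      ∫ z, ((if i = j then 1 else 0) * ψ z + z i * partialDeriv j ψ z) * f (x - t • z) := by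
    intro i j
    have h := integral_mul_partialDeriv hF (hw i) hψ.compact.mul_left j
    simp only [hdF, hdw] at h
    have e1 : ∫ z, ((if i = j then 1 else 0) * ψ z + z i * partialDeriv j ψ z) * f (x - t • z) =
        ∫ z, f (x - t • z) * ((if i = j then 1 else 0) * ψ z + z i * partialDeriv j ψ z) :=
      integral_congr_ae (.of_forall fun z => mul_comm _ _)
    rw [e1, h, ← integral_const_mul, ← integral_neg]
    exact integral_congr_ae (.of_forall fun z => by ring)
  have key : ∫ z, z i * ψ z * partialDeriv j f (x - t • z) =
      ∫ z, z j * ψ z * partialDeriv i f (x - t • z) := by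
    refine mul_left_cancel₀ ht ?_
    rw [hparts, hparts]
    simp_rw [hrad i j, eq_comm (a := i)]
  simpa [segWeight, segPoint, mul_comm] using key

/-- Weak form of `div R = ∇(f - ψ * f)`. By symmetry `Rᵢⱼ` is an average of translates of `∂ᵢf`; the
two derivative indices can be exchanged under the integral against the test function, which leaves
`∂ᵢ` of the trace. -/
theorem integral_sum_riesz_mul_partialDeriv (hψ : IsBump ε ψ) (hψ1 : ∫ z, ψ z = 1)
    (hrad : ∀ (i j : Fin n) (z : E n), z i * partialDeriv j ψ z = z j * partialDeriv i ψ z)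
    (hf : ContDiff ℝ 1 f) (hfc : HasCompactSupport f) {χ : E n → ℝ}
    (hχ : ContDiff ℝ 2 χ) (hχc : HasCompactSupport χ) (i : Fin n) :
    ∑ j, ∫ x, riesz ψ f i j x * partialDeriv j χ x =
      ∫ x, (f x - mollify ψ f x) * partialDeriv i χ x := by
  have hχ' : ∀ j, Continuous (partialDeriv j χ) := fun j =>
    partialDeriv_continuous (hχ.of_le (by norm_num)) j
  have swap : ∀ j, ∫ x, riesz ψ f i j x * partialDeriv j χ x =
      ∫ x, riesz ψ f j j x * partialDeriv i χ x := by
    intro j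
    simp_rw [riesz_comm hψ hrad hf hfc i j]
    have hp : ∀ k l : Fin n, ∫ x, riesz ψ f j k x * partialDeriv l χ x =
        ∫ ξ, segWeight ψ 0 j ξ * ∫ x, partialDeriv k f (x - segPoint 0 ξ) * partialDeriv l χ x
          ∂volume ∂(segMeasure volume) := fun k l => by
      have : SFinite (segMeasure (volume : Measure (E n))) := by
        unfold segMeasure; infer_instance
      exact integral_transAvg_mul (hψ.integrable_segWeight j) measurable_segPoint
        (partialDeriv_continuous hf k) (HasCompactSupport.partialDeriv hfc k)
        (hχ' l) (HasCompactSupport.partialDeriv hχc l)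
    rw [hp, hp]
    congr 1
    ext ξ
    congr 1
    have := integral_partialDeriv_mul_partialDeriv_comm
      (f := fun y => f (y - segPoint 0 ξ)) (by fun_prop) hχ hχc i j
    simpa only [partialDeriv_comp_sub] using this
  simp_rw [swap]
  rw [← integral_finsetSum]
  · simp_rw [← Finset.sum_mul, sum_riesz hψ hψ1 hf hfc]
  · intro j _
    exact ((continuous_riesz hψ hf hfc j j).mul (hχ' i)).integrable_of_hasCompactSupport
      (HasCompactSupport.partialDeriv hχc i).mul_left

end Riesz

theorem exists_radial_bump {ε : ℝ} (hε : 0 < ε) :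
    ∃ ψ : E n → ℝ, IsBump ε ψ ∧ ∫ z, ψ z = 1 ∧
      ∀ (i j : Fin n) (z : E n), z i * partialDeriv j ψ z = z j * partialDeriv i ψ z := by
  -- Taking the profile in the squared norm keeps the bump smooth at the origin and makes its
  -- gradient a multiple of `z`.
  set h : ℝ → ℝ := fun s => Real.smoothTransition (1 - s / ε ^ 2) with hh
  have hsm : ContDiff ℝ ∞ h :=
    Real.smoothTransition.contDiff.comp (by fun_prop)
  set φ : E n → ℝ := fun z => h (‖z‖ ^ 2) with hφ
  have hφs : ContDiff ℝ ∞ φ := hsm.comp (contDiff_norm_sq ℝ)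
  have hsupp : Function.support φ ⊆ Metric.closedBall 0 ε := by
    intro z hz
    by_contra hz'
    refine hz (Real.smoothTransition.zero_of_nonpos ?_)
    have : ε < ‖z‖ := by simpa using hz'
    rw [sub_nonpos, one_le_div (by positivity)]
    gcongr
  have hts : tsupport φ ⊆ Metric.closedBall 0 ε :=
    closure_minimal hsupp Metric.isClosed_closedBall
  have hc : HasCompactSupport φ :=
    (isCompact_closedBall _ _).of_isClosed_subset (isClosed_tsupport _) hts
  have hpos : 0 < ∫ z, φ z := by
    refine hφs.continuous.integral_pos_of_hasCompactSupport_nonneg_nonzero hc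
      (fun z => Real.smoothTransition.nonneg _) (x := 0) ?_
    simp [hφ, hh]
  set C := ∫ z, φ z
  have hd : ∀ (j : Fin n) z, partialDeriv j φ z = deriv h (‖z‖ ^ 2) * (2 * z j) := by
    intro j z
    have h1 : HasFDerivAt (fun z : E n => ‖z‖ ^ 2) (2 • innerSL ℝ z) z :=
      (hasStrictFDerivAt_norm_sq z).hasFDerivAt
    have h2 := ((hsm.differentiable (by simp)) (‖z‖ ^ 2)).hasDerivAt.comp_hasFDerivAt z h1
    have h3 : fderiv ℝ φ z = _ := h2.fderiv
    rw [partialDeriv, h3]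
    simp [EuclideanSpace.inner_single_right]
  refine ⟨C⁻¹ • φ, ⟨contDiff_const.smul hφs, hc.smul_left (f := fun _ => C⁻¹),
    (tsupport_smul_subset_right (fun _ => C⁻¹) φ).trans hts⟩, ?_, fun i j z => ?_⟩
  · simp only [Pi.smul_apply, smul_eq_mul]
    rw [integral_const_mul, inv_mul_cancel₀ hpos.ne']
  · have hdiff := hφs.differentiable (by simp)
    rw [partialDeriv_const_smul hdiff, partialDeriv_const_smul hdiff, hd, hd]
    ring

/-! ### The interior of the convex hull of the constraint set -/

section Hull

theorem tensorSq_transpose (v : E n) : (tensorSq v).transpose = tensorSq v := by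
  ext i j
  simp [tensorSq, mul_comm]

theorem trace_tensorSq (v : E n) : (tensorSq v).trace = ‖v‖ ^ 2 := by
  simp [EuclideanSpace.real_norm_sq_eq, tensorSq, Matrix.trace, ← sq]

theorem sum_eigenvector_mul_eigenvector {A : Matrix (Fin n) (Fin n) ℝ} (hA : A.IsHermitian)
    (a b : Fin n) :
    ∑ i, hA.eigenvectorBasis i a * hA.eigenvectorBasis i b = (1 : Matrix _ _ ℝ) a b := by
  have h := hA.eigenvectorBasis.sum_inner_mul_inner (EuclideanSpace.single a (1 : ℝ))
    (EuclideanSpace.single b (1 : ℝ))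
  simpa [EuclideanSpace.inner_single_left, EuclideanSpace.inner_single_right, Matrix.one_apply,
    eq_comm] using! h

theorem sum_eigenvalue_eigenvector {A : Matrix (Fin n) (Fin n) ℝ} (hA : A.IsHermitian)
    (a b : Fin n) :
    ∑ i, hA.eigenvalues i * (hA.eigenvectorBasis i a * hA.eigenvectorBasis i b) = A a b := by
  have h : ∀ i, hA.eigenvalues i * hA.eigenvectorBasis i a =
      ∑ c, A a c * hA.eigenvectorBasis i c := fun i => by
    have := congrFun (hA.mulVec_eigenvectorBasis i) a
    simpa [Matrix.mulVec, dotProduct] using this.symm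
  simp_rw [← mul_assoc, h, Finset.sum_mul]
  rw [Finset.sum_comm]
  simp_rw [mul_assoc, ← Finset.mul_sum, sum_eigenvector_mul_eigenvector hA]
  simp [Matrix.one_apply]

theorem abs_dotProduct_mulVec_le (A : Matrix (Fin n) (Fin n) ℝ) (v : E n) :
    |∑ a, ∑ b, v a * A a b * v b| ≤ (∑ a, ∑ b, |A a b|) * ‖v‖ ^ 2 := by
  refine (Finset.abs_sum_le_sum_abs _ _).trans ?_
  rw [Finset.sum_mul]
  refine Finset.sum_le_sum fun a _ => (Finset.abs_sum_le_sum_abs _ _).trans ?_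
  rw [Finset.sum_mul]
  refine Finset.sum_le_sum fun b _ => ?_
  have ha : |v a| ≤ ‖v‖ := PiLp.norm_apply_le v a
  have hb : |v b| ≤ ‖v‖ := PiLp.norm_apply_le v b
  rw [abs_mul, abs_mul]
  calc |v a| * |A a b| * |v b| ≤ ‖v‖ * |A a b| * ‖v‖ := by gcongr
    _ = _ := by ring

/-- The eigenvalue is the value of the quadratic form at a unit eigenvector. -/
theorem abs_eigenvalue_le {A : Matrix (Fin n) (Fin n) ℝ} (hA : A.IsHermitian) (i : Fin n) :
    |hA.eigenvalues i| ≤ ∑ a, ∑ b, |A a b| := by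
  have h : ∀ a, hA.eigenvalues i * hA.eigenvectorBasis i a =
      ∑ c, A a c * hA.eigenvectorBasis i c := fun a => by
    have := congrFun (hA.mulVec_eigenvectorBasis i) a
    simpa [Matrix.mulVec, dotProduct] using this.symm
  have hnorm : ‖hA.eigenvectorBasis i‖ = 1 := hA.eigenvectorBasis.orthonormal.1 i
  have h2 := abs_dotProduct_mulVec_le A (hA.eigenvectorBasis i)
  simp_rw [mul_assoc, ← Finset.mul_sum, ← h] at h2
  have h3 : ∑ a, hA.eigenvectorBasis i a * (hA.eigenvalues i * hA.eigenvectorBasis i a) =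
      hA.eigenvalues i := by
    have h4 := EuclideanSpace.real_norm_sq_eq (hA.eigenvectorBasis i)
    rw [hnorm] at h4
    calc _ = hA.eigenvalues i * ∑ a, hA.eigenvectorBasis i a ^ 2 := by
          rw [Finset.mul_sum]; exact Finset.sum_congr rfl fun a _ => by ring
      _ = _ := by rw [← h4]; ring
  simpa [h3, hnorm] using h2

/-- The trace-free part `β (n v ⊗ v - I)` of `β n v ⊗ v` for a unit vector `v`. -/
def hullPoint (β : ℝ) (v : E n) (hv : ‖v‖ = 1) : SymTraceless n :=
  ⟨β • ((n : ℝ) • tensorSq v - 1), by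
    refine ⟨?_, ?_⟩
    · simp [Matrix.transpose_sub, tensorSq_transpose]
    · simp [Matrix.trace_sub, trace_tensorSq, hv]⟩

theorem mem_constraintSet {α β : ℝ} (hα : 0 < α) {v : E n} (hv : ‖v‖ = 1) {s : ℝ}
    (hs : s ^ 2 = α * β * n) : (s • v, hullPoint β v hv) ∈ constraintSet n α β := by
  have h : tensorSq (s • v) = s ^ 2 • tensorSq v := by
    ext i j
    simp [tensorSq]
    ring
  simp only [constraintSet, Set.mem_ofPred_eq, h, hullPoint, hs]
  ext i j
  simp
  field_simp
  ring

/-- With `vᵢ`, `lᵢ` the eigenvectors and eigenvalues of `U` and `R² = αβn`, the points `(±R vᵢ, β (n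
vᵢ ⊗ vᵢ - I))` lie in the constraint set. Weights `(cᵢ ± dᵢ) / 2` reproduce `(m, U)`: the sums `cᵢ`
give `U`, the differences `dᵢ` give `m`, and trace zero makes the `cᵢ` add up to one. The size
bounds give `|dᵢ| ≤ 1/(2n) ≤ cᵢ`, so the weights are nonnegative. -/
theorem mem_convexHull_constraintSet {α β : ℝ} (hα : 0 < α) (hβ : 0 < β) (hn : 0 < n)
    {m : E n} {U : SymTraceless n} (hm : ‖m‖ ≤ √(α * β * n) / (2 * n))
    (hU : ∑ a, ∑ b, |(U : Matrix (Fin n) (Fin n) ℝ) a b| ≤ β / 2) :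
    (m, U) ∈ convexHull ℝ (constraintSet n α β) := by
  have hA : (U : Matrix (Fin n) (Fin n) ℝ).IsHermitian := U.2.1
  have hn' : (0 : ℝ) < n := by exact_mod_cast hn
  set R := √(α * β * n) with hRdef
  have hR : 0 < R := Real.sqrt_pos.2 (by positivity)
  have hR2 : R ^ 2 = α * β * n := Real.sq_sqrt (by positivity)
  set v := hA.eigenvectorBasis
  set l := hA.eigenvalues
  have hv : ∀ i, ‖v i‖ = 1 := v.orthonormal.1
  have hsum : ∑ i, l i = 0 := by
    have h := hA.trace_eq_sum_eigenvalues
    rw [U.2.2] at h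
    simpa using h.symm
  have hl : ∀ i, |l i| ≤ β / 2 := fun i => (abs_eigenvalue_le hA i).trans hU
  set c : Fin n → ℝ := fun i => (1 / n) * (1 + l i / β)
  set d : Fin n → ℝ := fun i => inner ℝ (v i) m / R
  have hc : ∀ i, 1 / (2 * n) ≤ c i := fun i => by
    have h1 := (abs_le.1 (hl i)).1
    have h2 : -(1 / 2) ≤ l i / β := by rw [le_div_iff₀ hβ]; linarith
    calc (1 / (2 * n) : ℝ) = (1 / n) * (1 + -(1 / 2)) := by field_simp; norm_num
      _ ≤ _ := by simp only [c]; gcongr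
  have hd : ∀ i, |d i| ≤ 1 / (2 * n) := fun i => by
    have h1 : |inner ℝ (v i) m| ≤ ‖m‖ := by
      simpa [hv i] using abs_real_inner_le_norm (v i) m
    simp only [d]
    rw [abs_div, abs_of_pos hR, div_le_iff₀ hR]
    exact (h1.trans hm).trans_eq (by ring)
  have hcsum : ∑ i, c i = 1 := by
    simp only [c]
    rw [← Finset.mul_sum, Finset.sum_add_distrib, ← Finset.sum_div, hsum]
    simp [hn'.ne']
  have key : (∑ z : Fin n × Bool, ((c z.1 + (if z.2 then 1 else -1) * d z.1) / 2) •
      (((if z.2 then R else -R) • v z.1, hullPoint β (v z.1) (hv z.1)) : E n × SymTraceless n))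
      ∈ convexHull ℝ (constraintSet n α β) := by
    refine (convex_convexHull ℝ (constraintSet n α β)).sum_mem (fun z _ => ?_) ?_ (fun z _ => ?_)
    · have h1 := hc z.1
      have h2 := abs_le.1 ((hd z.1).trans (hc z.1))
      split_ifs <;> linarith
    · rw [Fintype.sum_prod_type, ← hcsum]
      refine Finset.sum_congr rfl fun i _ => ?_
      simp
      ring
    · refine subset_convexHull ℝ _ (mem_constraintSet hα _ ?_)
      split_ifs <;> simp [hR2]
  convert key using 1
  rw [Fintype.sum_prod_type]
  refine Prod.ext ?_ (Subtype.ext ?_)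
  · rw [Prod.fst_sum]
    refine (v.sum_repr' m).symm.trans (Finset.sum_congr rfl fun i _ => ?_)
    simp only [Fintype.sum_bool, d, Prod.fst_add, Prod.smul_fst, smul_smul, ← add_smul]
    congr 1
    simp
    field_simp
    ring
  · rw [Prod.snd_sum]
    refine Matrix.ext fun a b => ?_
    simp only [Fintype.sum_bool, Prod.snd_add, Prod.smul_snd, ← add_smul,
      AddSubmonoidClass.coe_finsetSum, Submodule.coe_smul, hullPoint, Matrix.sum_apply,
      Matrix.smul_apply, Matrix.sub_apply, tensorSq, Matrix.of_apply, smul_eq_mul]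
    have e : ∀ i, ((c i + (if True then 1 else -1) * d i) / 2 +
        (c i + (if false = true then 1 else -1) * d i) / 2) *
        (β * (n * (v i a * v i b) - (1 : Matrix (Fin n) (Fin n) ℝ) a b)) =
        β * (v i a * v i b) + l i * (v i a * v i b) -
          c i * (β * (1 : Matrix (Fin n) (Fin n) ℝ) a b) := fun i => by
      simp [c]
      field_simp
      ring
    refine Eq.trans ?_ (Finset.sum_congr rfl fun i _ => (e i).symm)
    rw [Finset.sum_sub_distrib, Finset.sum_add_distrib, ← Finset.mul_sum, ← Finset.sum_mul,
      hcsum, sum_eigenvector_mul_eigenvector hA, sum_eigenvalue_eigenvector hA]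
    ring

theorem mem_interior_convexHull_constraintSet {α β : ℝ} (hα : 0 < α) (hβ : 0 < β) (hn : 0 < n)
    {m : E n} {U : SymTraceless n} (hm : ‖m‖ < √(α * β * n) / (2 * n))
    (hU : ∑ a, ∑ b, |(U : Matrix (Fin n) (Fin n) ℝ) a b| < β / 2) :
    (m, U) ∈ interior (convexHull ℝ (constraintSet n α β)) := by
  refine mem_interior.2 ⟨{w | ‖w.1‖ < √(α * β * n) / (2 * n) ∧
    ∑ a, ∑ b, |(w.2 : Matrix (Fin n) (Fin n) ℝ) a b| < β / 2}, ?_, ?_, hm, hU⟩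
  · rintro ⟨m, U⟩ ⟨h1, h2⟩
    exact mem_convexHull_constraintSet hα hβ hn h1.le h2.le
  · have hcont : ∀ a b, Continuous fun w : E n × SymTraceless n =>
        (w.2 : Matrix (Fin n) (Fin n) ℝ) a b := fun a b =>
      (continuous_subtype_val.comp continuous_snd).matrix_elem a b
    exact (isOpen_lt continuous_fst.norm continuous_const).inter
      (isOpen_lt (continuous_finsetSum _ fun a _ => continuous_finsetSum _ fun b _ =>
        (hcont a b).abs) continuous_const)

end Hull

/-! ### The compactly supported fields -/

theorem integrable_mul_of_compact {f g : E n → ℝ} (hf : Continuous f) (hg : Continuous g)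
    (hgc : HasCompactSupport g) : Integrable fun x => f x * g x :=
  (hf.mul hg).integrable_of_hasCompactSupport hgc.mul_left

theorem integral_partialDeriv_eq_zero {f : E n → ℝ} (hf : ContDiff ℝ 1 f)
    (hfc : HasCompactSupport f) (i : Fin n) : ∫ x, partialDeriv i f x = 0 := by
  simpa [partialDeriv] using
    integral_mul_partialDeriv (f := fun _ => (1 : ℝ)) contDiff_const hf hfc i

theorem exists_isDivergence_mollify {D : Set (E n)} (hD : IsOpen D) (hDc : IsConnected D)
    {K : Set (E n)} (hK : IsCompact K) (hKD : K ⊆ D) {P : E n → ℝ} (hP : Integrable P)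
    (hPK : ∀ x ∉ K, P x = 0) (hP0 : ∫ x, P x = 0) :
    ∃ ε > 0, ∀ ψ : E n → ℝ, IsBump ε ψ → IsDivergence D (mollify ψ P) := by
  obtain ⟨y₀, hy₀⟩ := hDc.nonempty
  obtain ⟨ε, hε, h⟩ := exists_isDivergence_compact hD hDc.isPreconnected hK hKD hy₀
  refine ⟨ε, hε, fun ψ hψ => ?_⟩
  convert (h ψ hψ P hP hPK).neg using 1
  ext x
  -- Mean zero removes the mass collected at `y₀`.
  simp only [hP0, zero_mul, zero_sub, Pi.neg_apply, neg_neg, mollify]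
  rw [← integral_sub_left_eq_self (fun z => ψ z * P (x - z)) volume x]
  exact integral_congr_ae (.of_forall fun y => by simp [mul_comm])

section Fields

variable {ψ P : E n → ℝ} {W : Fin n → E n → ℝ}

/-- The scalar `n / (2 (n - 1))`. -/
def fluxConst (n : ℕ) : ℝ := n / (2 * (n - 1))

/-- The entries of the matrix field
`- n / (2 (n - 1)) (2 R P + ∇W + ∇Wᵀ - (2 / n) P I)`, with `R` the truncated double Riesz
transform. -/
def stressEntry (ψ P : E n → ℝ) (W : Fin n → E n → ℝ) (x : E n) (i j : Fin n) : ℝ :=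
  -fluxConst n * (2 * riesz ψ P i j x + partialDeriv i (W j) x + partialDeriv j (W i) x
    - if i = j then 2 / n * P x else 0)

/-- The vector field `n / (2 (n - 1) a) (∇ div W - ΔW)`. -/
def momentumField (a : ℝ) (W : Fin n → E n → ℝ) (x : E n) : E n :=
  WithLp.toLp 2 fun i => fluxConst n / a * ∑ j, (partialDeriv i (partialDeriv j (W j)) x -
    partialDeriv j (partialDeriv j (W i)) x)

theorem continuous_stressEntry {ε : ℝ} (hψ : IsBump ε ψ) (hP : ContDiff ℝ 1 P)
    (hPc : HasCompactSupport P) (hW : ∀ i, ContDiff ℝ 2 (W i)) (i j : Fin n) :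
    Continuous fun x => stressEntry ψ P W x i j := by
  have h1 := continuous_riesz hψ hP hPc i j
  have h2 : ∀ i j, Continuous (partialDeriv i (W j)) := fun i j =>
    partialDeriv_continuous ((hW j).of_le (by norm_num)) i
  have h3 := h2 i j
  have h4 := h2 j i
  have h5 := hP.continuous
  unfold stressEntry
  split_ifs <;> fun_prop

theorem continuous_partialDeriv_partialDeriv {f : E n → ℝ} (hf : ContDiff ℝ 2 f) (i j : Fin n) :
    Continuous (partialDeriv i (partialDeriv j f)) :=
  partialDeriv_continuous (partialDeriv_contDiff hf (by norm_num) j) i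

theorem continuous_momentumField (a : ℝ) (hW : ∀ i, ContDiff ℝ 2 (W i)) :
    Continuous (momentumField a W) := by
  refine (PiLp.continuous_toLp 2 _).comp (continuous_pi fun i => ?_)
  refine continuous_const.mul (continuous_finsetSum _ fun j _ => ?_)
  exact (continuous_partialDeriv_partialDeriv (hW j) i j).sub
    (continuous_partialDeriv_partialDeriv (hW i) j j)

/-- Two integrations by parts exchange the derivative indices `i, j`; the double sums of the two
terms then agree after relabelling and cancel. -/
theorem weakDivFree_momentumField (a : ℝ) (hW : ∀ i, ContDiff ℝ 2 (W i)) :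
    WeakDivFree (momentumField a W) := by
  rintro χ ⟨hχ, hχc⟩
  have hχ2 : ContDiff ℝ 2 χ := contDiff_infty.1 hχ 2
  have hd : ∀ j, ContDiff ℝ 1 (partialDeriv j χ) := fun j =>
    partialDeriv_contDiff hχ2 (by norm_num) j
  have hi : ∀ i j k l, Integrable
      (fun x => partialDeriv i (partialDeriv j (W k)) x * partialDeriv l χ x) := fun i j k l =>
    integrable_mul_of_compact (continuous_partialDeriv_partialDeriv (hW k) i j) (hd l).continuous
      (HasCompactSupport.partialDeriv hχc l)
  have hi2 : ∀ i j, Integrable (fun x =>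
      partialDeriv i (partialDeriv j (W j)) x * partialDeriv i χ x -
        partialDeriv j (partialDeriv j (W i)) x * partialDeriv i χ x) := fun i j =>
    (hi i j j i).sub (hi j j i i)
  have hp : ∀ i j k l, ∫ x, partialDeriv i (partialDeriv j (W k)) x * partialDeriv l χ x =
      - ∫ x, partialDeriv j (W k) x * partialDeriv i (partialDeriv l χ) x := fun i j k l => by
    rw [integral_mul_partialDeriv (partialDeriv_contDiff (hW k) (by norm_num) j) (hd l)
      (HasCompactSupport.partialDeriv hχc l), neg_neg]
  have e : ∀ x, ∑ i, momentumField a W x i * partialDeriv i χ x = fluxConst n / a *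
      ∑ i, ∑ j, (partialDeriv i (partialDeriv j (W j)) x * partialDeriv i χ x -
        partialDeriv j (partialDeriv j (W i)) x * partialDeriv i χ x) := fun x => by
    simp only [momentumField, Finset.mul_sum, Finset.sum_mul]
    exact Finset.sum_congr rfl fun i _ => Finset.sum_congr rfl fun j _ => by ring
  have hswap : ∀ i j, ∫ x, partialDeriv i (partialDeriv j (W j)) x * partialDeriv i χ x =
      ∫ x, partialDeriv i (partialDeriv i (W j)) x * partialDeriv j χ x := fun i j => by
    simp_rw [partialDeriv_comm (hW j) i j, hp, partialDeriv_comm hχ2 i j]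
  simp_rw [e]
  rw [integral_const_mul, integral_finsetSum _ fun i _ => integrable_finsetSum _ fun j _ => hi2 i j]
  have hsum : ∀ i, ∫ x, ∑ j, (partialDeriv i (partialDeriv j (W j)) x * partialDeriv i χ x -
      partialDeriv j (partialDeriv j (W i)) x * partialDeriv i χ x) =
      ∑ j, ((∫ x, partialDeriv i (partialDeriv i (W j)) x * partialDeriv j χ x) -
        ∫ x, partialDeriv j (partialDeriv j (W i)) x * partialDeriv i χ x) := fun i => by
    rw [integral_finsetSum _ fun j _ => hi2 i j]
    exact Finset.sum_congr rfl fun j _ => by rw [integral_sub (hi _ _ _ _) (hi _ _ _ _), hswap]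
  simp_rw [hsum, Finset.sum_sub_distrib]
  rw [Finset.sum_comm, sub_self, mul_zero]

theorem integral_momentum {ε a : ℝ} (ha : a ≠ 0) (hn : 2 ≤ n) (hψ : IsBump ε ψ)
    (hψ1 : ∫ z, ψ z = 1)
    (hrad : ∀ (i j : Fin n) (z : E n), z i * partialDeriv j ψ z = z j * partialDeriv i ψ z)
    (hP : ContDiff ℝ 1 P) (hPc : HasCompactSupport P) (hW : ∀ i, ContDiff ℝ 2 (W i))
    (hdiv : ∀ x, mollify ψ P x = ∑ i, partialDeriv i (W i) x) {χ : E n → ℝ}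
    (hχ : ContDiff ℝ 2 χ) (hχc : HasCompactSupport χ) (i : Fin n) :
    Integrable (fun x => (∑ j, stressEntry ψ P W x i j * partialDeriv j χ x) +
      P x * partialDeriv i χ x + a * momentumField a W x i * χ x) ∧
    ∫ x, ((∑ j, stressEntry ψ P W x i j * partialDeriv j χ x) + P x * partialDeriv i χ x +
      a * momentumField a W x i * χ x) = 0 := by
  have hχ1 : ContDiff ℝ 1 χ := hχ.of_le (by norm_num)
  have hdχ : ∀ j, Continuous (partialDeriv j χ) := partialDeriv_continuous hχ1
  have hdχc : ∀ j, HasCompactSupport (partialDeriv j χ) := HasCompactSupport.partialDeriv hχc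
  have hW1 : ∀ i j, ContDiff ℝ 1 (partialDeriv i (W j)) := fun i j =>
    partialDeriv_contDiff (hW j) (by norm_num) i
  have hn1 : (n : ℝ) - 1 ≠ 0 := by
    have : (2 : ℝ) ≤ n := by exact_mod_cast hn
    linarith
  have hn0 : (n : ℝ) ≠ 0 := by positivity
  set c := fluxConst n with hc
  set T : Fin n → E n → ℝ := fun j x => (-2 * c) * (riesz ψ P i j x * partialDeriv j χ x) +
    (-c) * (partialDeriv i (W j) x * partialDeriv j χ x) +
    (-c) * (partialDeriv j (W i) x * partialDeriv j χ x) +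
    c * (partialDeriv i (partialDeriv j (W j)) x * χ x) +
    (-c) * (partialDeriv j (partialDeriv j (W i)) x * χ x) with hT
  have e : ∀ x, (∑ j, stressEntry ψ P W x i j * partialDeriv j χ x) + P x * partialDeriv i χ x +
      a * momentumField a W x i * χ x =
      (∑ j, T j x) + (2 / n * c + 1) * (P x * partialDeriv i χ x) := by
    intro x
    have e1 : ∑ j, (if i = j then 2 / n * P x else 0) * (c * partialDeriv j χ x) =
        2 / n * c * (P x * partialDeriv i χ x) := by
      simp
      ring
    have e2 : a * momentumField a W x i * χ x = ∑ j, (c *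
        (partialDeriv i (partialDeriv j (W j)) x * χ x) +
        (-c) * (partialDeriv j (partialDeriv j (W i)) x * χ x)) := by
      simp only [momentumField, Finset.mul_sum, Finset.sum_mul, ← hc]
      refine Finset.sum_congr rfl fun j _ => ?_
      field_simp
      ring
    rw [e2, add_mul, ← e1, one_mul, add_right_comm, ← add_assoc, add_left_inj,
      ← Finset.sum_add_distrib, ← Finset.sum_add_distrib]
    refine Finset.sum_congr rfl fun j _ => ?_
    simp only [stressEntry, hT, ← hc]
    ring
  have h1 : ∀ j, Integrable fun x => riesz ψ P i j x * partialDeriv j χ x := fun j =>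
    integrable_mul_of_compact (continuous_riesz hψ hP hPc i j) (hdχ j) (hdχc j)
  have h2 : ∀ k l j, Integrable fun x => partialDeriv k (W l) x * partialDeriv j χ x :=
    fun k l j => integrable_mul_of_compact (hW1 k l).continuous (hdχ j) (hdχc j)
  have h3 : ∀ k l j, Integrable fun x => partialDeriv k (partialDeriv l (W j)) x * χ x :=
    fun k l j => integrable_mul_of_compact (continuous_partialDeriv_partialDeriv (hW j) k l)
      hχ.continuous hχc
  have h4 : Integrable fun x => P x * partialDeriv i χ x :=
    integrable_mul_of_compact hP.continuous (hdχ i) (hdχc i)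
  have t1 : ∀ j, Integrable fun x => (-2 * c) * (riesz ψ P i j x * partialDeriv j χ x) :=
    fun j => (h1 j).const_mul _
  have t2 : ∀ j, Integrable fun x => (-2 * c) * (riesz ψ P i j x * partialDeriv j χ x) +
    (-c) * (partialDeriv i (W j) x * partialDeriv j χ x) :=
    fun j => (t1 j).add ((h2 _ _ _).const_mul _)
  have t3 : ∀ j, Integrable fun x => (-2 * c) * (riesz ψ P i j x * partialDeriv j χ x) +
    (-c) * (partialDeriv i (W j) x * partialDeriv j χ x) +
    (-c) * (partialDeriv j (W i) x * partialDeriv j χ x) :=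
    fun j => (t2 j).add ((h2 _ _ _).const_mul _)
  have t4 : ∀ j, Integrable fun x => (-2 * c) * (riesz ψ P i j x * partialDeriv j χ x) +
    (-c) * (partialDeriv i (W j) x * partialDeriv j χ x) +
    (-c) * (partialDeriv j (W i) x * partialDeriv j χ x) +
    c * (partialDeriv i (partialDeriv j (W j)) x * χ x) :=
    fun j => (t3 j).add ((h3 _ _ _).const_mul _)
  have t5 : ∀ j, Integrable (T j) := fun j => (t4 j).add ((h3 _ _ _).const_mul _)
  have t6 : Integrable fun x => ∑ j, T j x := integrable_finsetSum _ fun j _ => t5 j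
  simp_rw [e]
  refine ⟨t6.add (h4.const_mul _), ?_⟩
  -- The terms with `∂ⱼWᵢ` cancel against the Laplacian part of the momentum; those with `∂ᵢWⱼ`
  -- leave two copies of `div W`, with the sign that completes `P - ψ * P` to `P`.
  have hTint : ∀ j, ∫ x, T j x = (-2 * c) * ((∫ x, riesz ψ P i j x * partialDeriv j χ x) +
      ∫ x, partialDeriv j (W j) x * partialDeriv i χ x) := by
    intro j
    have p1 := integral_mul_partialDeriv (hW1 i j) hχ1 hχc j
    have p2 := integral_mul_partialDeriv (hW1 j i) hχ1 hχc j
    have p3 := integral_mul_partialDeriv (hW1 j j) hχ1 hχc i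
    simp only [hT]
    rw [integral_add (t4 j) ((h3 _ _ _).const_mul _), integral_add (t3 j) ((h3 _ _ _).const_mul _),
      integral_add (t2 j) ((h2 _ _ _).const_mul _), integral_add (t1 j) ((h2 _ _ _).const_mul _)]
    simp_rw [integral_const_mul]
    rw [p1, p2, p3]
    simp_rw [partialDeriv_comm (hW j) i j]
    ring
  have hS : ∑ j, ∫ x, partialDeriv j (W j) x * partialDeriv i χ x =
      ∫ x, mollify ψ P x * partialDeriv i χ x := by
    rw [← integral_finsetSum _ fun j _ => h2 j j i]
    simp_rw [hdiv, Finset.sum_mul]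
  have h5 : Integrable fun x => mollify ψ P x * partialDeriv i χ x := by
    simp_rw [hdiv, Finset.sum_mul]
    exact integrable_finsetSum _ fun j _ => h2 j j i
  have hR := integral_sum_riesz_mul_partialDeriv hψ hψ1 hrad hP hPc hχ hχc i
  simp_rw [sub_mul] at hR
  rw [integral_sub h4 h5] at hR
  rw [integral_add t6 (h4.const_mul _), integral_finsetSum _ fun j _ => t5 j]
  simp_rw [hTint]
  -- The coefficient of `∫ P ∂ᵢχ` is now `-2c + 2c/n + 1`, which vanishes by the choice of `c`.
  rw [← Finset.mul_sum, Finset.sum_add_distrib, hR, hS, integral_const_mul, hc, fluxConst]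
  field_simp
  ring

end Fields

theorem exists_compactly_supported_flux (hn : 2 ≤ n) {a : ℝ} (ha : a ≠ 0) {D K : Set (E n)}
    (hD : IsOpen D) (hDc : IsConnected D) (hK : IsCompact K) (hKD : K ⊆ D) {P : E n → ℝ}
    (hP : ContDiff ℝ 1 P) (hPK : tsupport P ⊆ K) (hP0 : ∫ x, P x = 0) :
    ∃ (U : E n → SymTraceless n) (m : E n → E n), Continuous m ∧ Continuous U ∧
      HasCompactSupport (fun x => (m x, U x)) ∧ tsupport (fun x => (m x, U x)) ⊆ D ∧
      WeakDivFree m ∧ WeakMomentum (a • (1 : Matrix (Fin n) (Fin n) ℝ)) m U P := by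
  have hPc : HasCompactSupport P := hK.of_isClosed_subset (isClosed_tsupport P) hPK
  have hn0 : (n : ℝ) ≠ 0 := by positivity
  obtain ⟨δ, hδ, hδD⟩ := hK.exists_cthickening_subset_open hD hKD
  obtain ⟨ε, hε, hdiv⟩ := exists_isDivergence_mollify hD hDc hK hKD
    (hP.continuous.integrable_of_hasCompactSupport hPc)
    (fun x hx => image_eq_zero_of_notMem_tsupport fun h => hx (hPK h)) hP0
  -- Radius below `ε` makes `ψ * P` a divergence in `D`; radius below `δ` keeps the support of
  -- `riesz` in the thickening of `K`.
  obtain ⟨ψ, hψ, hψ1, hrad⟩ := exists_radial_bump (n := n) (lt_min hε hδ)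
  obtain ⟨W, hW, hWc, hWD, hdiv⟩ := hdiv ψ (hψ.mono (min_le_left _ _))
  have hψδ := hψ.mono (min_le_right ε δ)
  have hW2 : ∀ i, ContDiff ℝ 2 (W i) := fun i => contDiff_infty.1 (hW i) 2
  set L : Set (E n) := Metric.cthickening δ K ∪ ⋃ i, tsupport (W i) with hL
  have hLc : IsCompact L := hK.cthickening.union (isCompact_iUnion fun i => hWc i)
  have hLD : L ⊆ D := Set.union_subset hδD (Set.iUnion_subset hWD)
  have hWL : ∀ x ∉ L, ∀ i, x ∉ tsupport (W i) := fun x hx i h =>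
    hx (Or.inr (Set.mem_iUnion.2 ⟨i, h⟩))
  have hdW : ∀ x ∉ L, ∀ i j, partialDeriv i (W j) x = 0 := fun x hx i j =>
    image_eq_zero_of_notMem_tsupport fun h => hWL x hx j (tsupport_partialDeriv_subset _ _ h)
  have hddW : ∀ x ∉ L, ∀ i j k, partialDeriv i (partialDeriv j (W k)) x = 0 := fun x hx i j k =>
    image_eq_zero_of_notMem_tsupport fun h => hWL x hx k
      (tsupport_partialDeriv_subset _ _ (tsupport_partialDeriv_subset _ _ h))
  have hPL : ∀ x ∉ L, P x = 0 := fun x hx => image_eq_zero_of_notMem_tsupport fun h =>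
    hx (Or.inl (Metric.self_subset_cthickening K (hPK h)))
  have hRL : ∀ x ∉ L, ∀ i j, riesz ψ P i j x = 0 := fun x hx i j =>
    image_eq_zero_of_notMem_tsupport fun h => hx (Or.inl (by
      rw [← hK.add_closedBall_zero hδ.le]
      exact Set.add_subset_add_right hPK (tsupport_riesz_subset hψδ hPc i j h)))
  have hsym : ∀ x i j, stressEntry ψ P W x i j = stressEntry ψ P W x j i := fun x i j => by
    simp only [stressEntry, riesz_comm hψ hrad hP hPc i j, eq_comm (a := i)]
    ring
  have htr : ∀ x, ∑ i, stressEntry ψ P W x i i = 0 := fun x => by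
    simp only [stressEntry, ← Finset.mul_sum, Finset.sum_sub_distrib, Finset.sum_add_distrib,
      sum_riesz hψ hψ1 hP hPc, ← hdiv, if_true, Finset.sum_const, Finset.card_univ,
      Fintype.card_fin, nsmul_eq_mul]
    field_simp
    ring
  have hUc : Continuous fun x => (Matrix.of (stressEntry ψ P W x) : Matrix (Fin n) (Fin n) ℝ) :=
    continuous_pi fun i => continuous_pi fun j => continuous_stressEntry hψ hP hPc hW2 i j
  refine ⟨fun x => ⟨Matrix.of (stressEntry ψ P W x), Matrix.ext fun i j => hsym x j i, htr x⟩,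
    momentumField a W, continuous_momentumField a hW2, hUc.subtype_mk _, ?_⟩
  have hts : tsupport (fun x => (momentumField a W x, (⟨Matrix.of (stressEntry ψ P W x),
      Matrix.ext fun i j => hsym x j i, htr x⟩ : SymTraceless n))) ⊆ L := by
    refine closure_minimal (fun x hx => by_contra fun hxL => hx ?_) hLc.isClosed
    refine Prod.ext ?_ (Subtype.ext (Matrix.ext fun i j => ?_))
    · ext i
      simp [momentumField, hddW x hxL]
    · simp [stressEntry, hRL x hxL, hdW x hxL, hPL x hxL]
  refine ⟨hLc.of_isClosed_subset (isClosed_tsupport _) hts, hts.trans hLD,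
    weakDivFree_momentumField a hW2, ?_⟩
  rintro i χ ⟨hχ, hχc⟩
  have h := (integral_momentum ha hn hψ hψ1 hrad hP hPc hW2 hdiv
    (contDiff_infty.1 hχ 2) hχc i).2
  simpa [Matrix.smul_mulVec] using h

/-! ### Largeness of the pressure level -/

theorem posDef_of_bounds {ρ q : ℝ} (hρ : 0 < ρ) {m : E n} {U : SymTraceless n}
    (h : ‖m‖ ^ 2 + ρ * ∑ a, ∑ b, |(U : Matrix (Fin n) (Fin n) ℝ) a b| < ρ * q) :
    ((ρ * q) • (1 : Matrix (Fin n) (Fin n) ℝ) -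
      (tensorSq m - ρ • (U : Matrix (Fin n) (Fin n) ℝ))).PosDef := by
  refine Matrix.PosDef.of_dotProduct_mulVec_pos ?_ fun x hx => ?_
  · have hU : (U : Matrix (Fin n) (Fin n) ℝ).transpose = U := U.2.1
    simp [Matrix.IsHermitian, Matrix.conjTranspose_eq_transpose_of_trivial, tensorSq_transpose, hU]
  · set v : E n := WithLp.toLp 2 x with hv
    have hv0 : 0 < ‖v‖ ^ 2 := by
      have : v ≠ 0 := fun h0 => hx (by simpa [hv] using h0)
      positivity
    have e1 : star x ⬝ᵥ (tensorSq m).mulVec x = (inner ℝ m v) ^ 2 := by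
      rw [sq, PiLp.inner_apply, Finset.sum_mul_sum]
      simp only [dotProduct, Matrix.mulVec, tensorSq, Matrix.of_apply, hv, Finset.mul_sum]
      refine Finset.sum_congr rfl fun i _ => Finset.sum_congr rfl fun j _ => ?_
      simp
      ring
    have e2 : star x ⬝ᵥ (U : Matrix (Fin n) (Fin n) ℝ).mulVec x =
        ∑ a, ∑ b, v a * (U : Matrix (Fin n) (Fin n) ℝ) a b * v b := by
      simp [dotProduct, Matrix.mulVec, Finset.mul_sum, hv, mul_assoc]
    have e3 : star x ⬝ᵥ x = ‖v‖ ^ 2 := by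
      rw [EuclideanSpace.real_norm_sq_eq]
      simp [dotProduct, hv, sq]
    rw [Matrix.sub_mulVec, Matrix.sub_mulVec, Matrix.smul_mulVec, Matrix.smul_mulVec,
      Matrix.one_mulVec, dotProduct_sub, dotProduct_sub, dotProduct_smul, dotProduct_smul,
      e1, e2, e3, smul_eq_mul, smul_eq_mul]
    have h1 : (inner ℝ m v) ^ 2 ≤ ‖m‖ ^ 2 * ‖v‖ ^ 2 := by
      rw [← mul_pow, sq_le_sq, abs_of_nonneg (a := ‖m‖ * ‖v‖) (by positivity)]
      exact abs_real_inner_le_norm m v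
    have h2 := mul_le_mul_of_nonneg_left
      (abs_le.1 (abs_dotProduct_mulVec_le (U : Matrix (Fin n) (Fin n) ℝ) v)).1 hρ.le
    have h3 := mul_lt_mul_of_pos_right h hv0
    linarith

/-- The threshold adds up the two requirements of the hull lemma: `4 n M² / ρ < β` for the momentum
and `2 N < β` for the stress, with `κ` bounding `1 / ρ`. -/
theorem mem_interior_of_bounds {ρ β κ M N : ℝ} (hn : 0 < n) (hρ : 0 < ρ) (hκ : ρ⁻¹ ≤ κ)
    (hβ : 4 * n * M ^ 2 * κ + 2 * N < β) {m : E n} {U : SymTraceless n} (hm : ‖m‖ ≤ M)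
    (hU : ∑ a, ∑ b, |(U : Matrix (Fin n) (Fin n) ℝ) a b| ≤ N) :
    0 < β ∧ (m, U) ∈ interior (convexHull ℝ (constraintSet n ρ β)) := by
  have hn' : (0 : ℝ) < n := by exact_mod_cast hn
  have hM : 0 ≤ M := (norm_nonneg m).trans hm
  have hN : 0 ≤ N := le_trans (by positivity) hU
  have hκ0 : 0 < κ := (inv_pos.2 hρ).trans_le hκ
  have hMκ : 0 ≤ 4 * n * M ^ 2 * κ := by positivity
  have hβ0 : 0 < β := by linarith
  refine ⟨hβ0, mem_interior_convexHull_constraintSet hρ hβ0 hn ?_ (by linarith)⟩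
  refine hm.trans_lt ?_
  rw [lt_div_iff₀ (by positivity)]
  refine Real.lt_sqrt_of_sq_lt ?_
  have h1 : 1 ≤ ρ * κ := by
    rw [← mul_inv_cancel₀ hρ.ne']
    gcongr
  calc (M * (2 * n)) ^ 2 = n * (4 * n * M ^ 2 * 1) := by ring
    _ ≤ n * (4 * n * M ^ 2 * (ρ * κ)) := by gcongr
    _ = (ρ * n) * (4 * n * M ^ 2 * κ) := by ring
    _ < (ρ * n) * β := by gcongr; linarith
    _ = ρ * β * n := by ring

theorem posDef_of_level_bounds {ρ β κ M N : ℝ} (hn : 0 < n) (hρ : 0 < ρ) (hκ : ρ⁻¹ ≤ κ)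
    (hβ : 4 * n * M ^ 2 * κ + 2 * N < β) {m : E n} {U : SymTraceless n} (hm : ‖m‖ ≤ M)
    (hU : ∑ a, ∑ b, |(U : Matrix (Fin n) (Fin n) ℝ) a b| ≤ N) :
    ((ρ * β) • (1 : Matrix (Fin n) (Fin n) ℝ) -
      (tensorSq m - ρ • (U : Matrix (Fin n) (Fin n) ℝ))).PosDef := by
  refine posDef_of_bounds hρ ?_
  have hn' : (1 : ℝ) ≤ n := by exact_mod_cast hn
  have hN : 0 ≤ N := le_trans (by positivity) hU
  have hκ0 : 0 < κ := (inv_pos.2 hρ).trans_le hκ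
  have h1 : 1 ≤ ρ * κ := by
    rw [← mul_inv_cancel₀ hρ.ne']
    gcongr
  calc ‖m‖ ^ 2 + ρ * ∑ a, ∑ b, |(U : Matrix (Fin n) (Fin n) ℝ) a b|
      ≤ 1 * 1 * M ^ 2 * 1 + ρ * (1 * N) := by rw [one_mul, one_mul, one_mul, mul_one]; gcongr
    _ ≤ 4 * n * M ^ 2 * (ρ * κ) + ρ * (2 * N) := by gcongr <;> linarith
    _ = ρ * (4 * n * M ^ 2 * κ + 2 * N) := by ring
    _ < ρ * β := by gcongr

theorem exists_abs_le_of_eq_off_compact {f : E n → ℝ} (hf : Continuous f) {K : Set (E n)}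
    (hK : IsCompact K) {c : ℝ} (hfK : ∀ x ∉ K, f x = c) : ∃ C, ∀ x, |f x| ≤ C := by
  obtain ⟨C, hC⟩ := hK.exists_bound_of_continuousOn hf.continuousOn
  refine ⟨max C |c|, fun x => ?_⟩
  by_cases hx : x ∈ K
  · exact (hC x hx).trans (le_max_left _ _)
  · rw [hfK x hx]
    exact le_max_right _ _

theorem weakMomentum_add_const {B : Matrix (Fin n) (Fin n) ℝ} {m : E n → E n}
    {U : E n → SymTraceless n} {P : E n → ℝ} (hm : Continuous m) (hU : Continuous U)
    (hP : Continuous P) (h : WeakMomentum B m U P) (c : ℝ) :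
    WeakMomentum B m U (fun x => P x + c) := by
  rintro i χ ⟨hχ, hχc⟩
  have hχ1 : ContDiff ℝ 1 χ := contDiff_infty.1 hχ 1
  have hdχ : ∀ j, Continuous (partialDeriv j χ) := partialDeriv_continuous hχ1
  have hdχc : ∀ j, HasCompactSupport (partialDeriv j χ) := HasCompactSupport.partialDeriv hχc
  have hUe : ∀ j, Continuous fun x => (U x : Matrix (Fin n) (Fin n) ℝ) i j := fun j =>
    (continuous_subtype_val.comp hU).matrix_elem i j
  have hBm : Continuous fun x => B.mulVec (m x).ofLp i := by
    simp only [Matrix.mulVec, dotProduct]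
    fun_prop
  have h1 : Integrable fun x => (∑ j, (U x : Matrix (Fin n) (Fin n) ℝ) i j * partialDeriv j χ x) +
      P x * partialDeriv i χ x + B.mulVec (m x).ofLp i * χ x :=
    ((integrable_finsetSum _ fun j _ => integrable_mul_of_compact (hUe j) (hdχ j) (hdχc j)).add
      (integrable_mul_of_compact hP (hdχ i) (hdχc i))).add
      (integrable_mul_of_compact hBm hχ.continuous hχc)
  have h2 : Integrable fun x => c * partialDeriv i χ x :=
    integrable_mul_of_compact continuous_const (hdχ i) (hdχc i)
  have h3 := integral_add h1 h2
  rw [h i χ ⟨hχ, hχc⟩, integral_const_mul, integral_partialDeriv_eq_zero hχ1 hχc, mul_zero,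
    add_zero] at h3
  rw [← h3]
  exact integral_congr_ae (.of_forall fun x => by ring)

end SteadyEuler

end

/-! ### Assembly of the strict subsolution -/

theorem proposition4p5 (n : ℕ) (hn : 3 ≤ n) (a : ℝ) (ha : a ≠ 0)
    (B : Matrix (Fin n) (Fin n) ℝ) (hB : B = a • (1 : Matrix (Fin n) (Fin n) ℝ))
    (Ω Ω' : Set (EuclideanSpace ℝ (Fin n)))
    (hΩ_open : IsOpen Ω)
    (hΩ'_open : IsOpen Ω') (hΩ'_conn : IsConnected Ω') (hΩ'_bdd : Bornology.IsBounded Ω')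
    (hΩΩ' : closure Ω ⊆ Ω')
    (ρ : EuclideanSpace ℝ (Fin n) → ℝ) (hρ : ContDiff ℝ 1 ρ) (hρ_pos : ∀ x, 0 < ρ x)
    (ρbar : ℝ) (hρbar : ∀ x, x ∉ Ω → ρ x = ρbar)
    (p : ℝ → ℝ) (hp : ContDiffOn ℝ 1 p (Set.Ioi 0))
    (hint : ∫ x in Ω, p (ρ x) = p ρbar * (MeasureTheory.volume Ω).toReal) :
    ∃ (U : EuclideanSpace ℝ (Fin n) → SteadyEuler.SymTraceless n)
      (m : EuclideanSpace ℝ (Fin n) → EuclideanSpace ℝ (Fin n))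
      (χ : ℝ) (q : EuclideanSpace ℝ (Fin n) → ℝ),
      (∀ x, q x = p (ρ x) + χ / n) ∧
      Continuous m ∧ Continuous U ∧
      HasCompactSupport (fun x => (m x, U x)) ∧
      tsupport (fun x => (m x, U x)) ⊆ Ω' ∧
      SteadyEuler.WeakDivFree m ∧
      SteadyEuler.WeakMomentum B m U q ∧
      (∀ x, ((ρ x * q x) • (1 : Matrix (Fin n) (Fin n) ℝ)
        - (SteadyEuler.tensorSq (m x) - ρ x • (U x : Matrix (Fin n) (Fin n) ℝ))).PosDef) ∧
      (∀ x, 0 < q x ∧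
        (m x, U x) ∈ interior (convexHull ℝ (SteadyEuler.constraintSet n (ρ x) (q x)))) ∧
      SteadyEuler.IsStrictSubsolution p B ρ m U (fun _ => χ / n) Set.univ := by
  subst hB
  have hn0 : 0 < n := by omega
  have hn' : (n : ℝ) ≠ 0 := by positivity
  have hΩ_bdd : Bornology.IsBounded Ω := hΩ'_bdd.subset (subset_closure.trans hΩΩ')
  have hK : IsCompact (closure Ω) := hΩ_bdd.isCompact_closure
  have hnotin : ∀ x, x ∉ closure Ω → x ∉ Ω := fun x hx h => hx (subset_closure h)
  have hpρ : ContDiff ℝ 1 (fun x => p (ρ x)) :=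
    contDiffOn_univ.1 (hp.comp hρ.contDiffOn fun x _ => hρ_pos x)
  have hpρbar : ∀ x ∉ Ω, p (ρ x) = p ρbar := fun x hx => by rw [hρbar x hx]
  set P : EuclideanSpace ℝ (Fin n) → ℝ := fun x => p (ρ x) - p ρbar with hPdef
  have hP : ContDiff ℝ 1 P := hpρ.sub contDiff_const
  have hP_off : ∀ x ∉ Ω, P x = 0 := fun x hx => by simp [hPdef, hpρbar x hx]
  have hPK : tsupport P ⊆ closure Ω :=
    closure_mono fun x hx => by_contra fun h => hx (hP_off x h)
  have hPc : HasCompactSupport P := hK.of_isClosed_subset (isClosed_tsupport P) hPK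
  have hPi : Integrable P := hP.continuous.integrable_of_hasCompactSupport hPc
  have hP0 : ∫ x, P x = 0 := by
    have hfin : volume Ω ≠ ⊤ := hΩ_bdd.measure_lt_top.ne
    have hc : IntegrableOn (fun _ => p ρbar) Ω := integrableOn_const hfin
    have hpi : IntegrableOn (fun x => p (ρ x)) Ω :=
      (hPi.integrableOn.add hc).congr (.of_forall fun x => by simp [hPdef])
    rw [← setIntegral_eq_integral_of_forall_compl_eq_zero (s := Ω) fun x hx => hP_off x hx,
      integral_sub hpi hc, hint]
    simp [Measure.real, mul_comm]
  obtain ⟨U, m, hmc, hUc, hcs, hts, hdiv, hmom⟩ :=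
    SteadyEuler.exists_compactly_supported_flux (by omega) ha hΩ'_open hΩ'_conn hK hΩΩ' hP hPK hP0
  have hUe : ∀ i j, Continuous fun x => (U x : Matrix (Fin n) (Fin n) ℝ) i j := fun i j =>
    (continuous_subtype_val.comp hUc).matrix_elem i j
  have hoff : ∀ x ∉ tsupport (fun x => (m x, U x)), m x = 0 ∧ U x = 0 := fun x hx =>
    Prod.mk_eq_zero.1
    (image_eq_zero_of_notMem_tsupport (f := fun x => (m x, U x)) hx)
  obtain ⟨M, hM⟩ := SteadyEuler.exists_abs_le_of_eq_off_compact hmc.norm hcs (c := 0)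
    fun x hx => by simp [(hoff x hx).1]
  obtain ⟨N, hN⟩ := SteadyEuler.exists_abs_le_of_eq_off_compact
    (f := fun x => ∑ i, ∑ j, |(U x : Matrix (Fin n) (Fin n) ℝ) i j|)
    (continuous_finsetSum _ fun i _ => continuous_finsetSum _ fun j _ => (hUe i j).abs)
    hcs (c := 0) fun x hx => by simp [(hoff x hx).2]
  obtain ⟨Q, hQ⟩ := SteadyEuler.exists_abs_le_of_eq_off_compact hpρ.continuous hK (c := p ρbar)
    fun x hx => hpρbar x (hnotin x hx)
  obtain ⟨R, hR⟩ := SteadyEuler.exists_abs_le_of_eq_off_compact hρ.continuous hK (c := ρbar)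
    fun x hx => hρbar x (hnotin x hx)
  obtain ⟨κ, hκ⟩ := SteadyEuler.exists_abs_le_of_eq_off_compact
    (hρ.continuous.inv₀ fun x => (hρ_pos x).ne') hK (c := ρbar⁻¹)
    fun x hx => by rw [Pi.inv_apply, hρbar x (hnotin x hx)]
  have hM' : ∀ x, ‖m x‖ ≤ M := fun x => (le_abs_self _).trans (hM x)
  have hN' : ∀ x, ∑ i, ∑ j, |(U x : Matrix (Fin n) (Fin n) ℝ) i j| ≤ N := fun x =>
    (le_abs_self _).trans (hN x)
  have hκ' : ∀ x, (ρ x)⁻¹ ≤ κ := fun x => (le_abs_self _).trans (hκ x)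
  set b : ℝ := 4 * n * M ^ 2 * κ + 2 * N with hb
  -- Since `|p(ρ)| ≤ Q`, both levels `r` and `p(ρ) + r` exceed the threshold `b`.
  set r : ℝ := b + Q + 1 with hr
  have hQ0 : 0 ≤ Q := (abs_nonneg _).trans (hQ 0)
  have hbr : b < r := by linarith
  have hbq : ∀ x, b < p (ρ x) + r := fun x => by linarith [(abs_le.1 (hQ x)).1]
  have hχ : (n * r : ℝ) / n = r := by field_simp
  have hmom' : SteadyEuler.WeakMomentum (a • (1 : Matrix (Fin n) (Fin n) ℝ)) m U
      (fun x => p (ρ x) + r) := by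
    -- The constant restores the `p ρbar` subtracted in `P` and adds the level `r`.
    convert SteadyEuler.weakMomentum_add_const hmc hUc hP.continuous hmom (p ρbar + r) using 2
    simp only [hPdef]
    ring
  have hlevel : ∀ x, 0 < r ∧
      (m x, U x) ∈ interior (convexHull ℝ (SteadyEuler.constraintSet n (ρ x) r)) := fun x =>
    SteadyEuler.mem_interior_of_bounds hn0 (hρ_pos x) (hκ' x) hbr (hM' x) (hN' x)
  refine ⟨U, m, n * r, fun x => p (ρ x) + r, fun x => by rw [hχ], hmc, hUc, hcs, hts, hdiv,
    hmom', fun x => SteadyEuler.posDef_of_level_bounds hn0 (hρ_pos x) (hκ' x) (hbq x) (hM' x)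
      (hN' x), fun x => SteadyEuler.mem_interior_of_bounds hn0 (hρ_pos x) (hκ' x) (hbq x) (hM' x)
      (hN' x), ?_⟩
  rw [hχ]
  refine { bdd_density := ?_, bdd_momentum := ?_, bdd_stress := ?_, bdd_level := ?_,
           density_pos := .of_forall hρ_pos, div_free := hdiv, momentum := hmom',
           mem_hull := .of_forall fun x => interior_subset (hlevel x).2,
           isOpen_domain := isOpen_univ, continuous_density := hρ.continuous,
           continuous_momentum := hmc, continuous_stress := hUc,
           continuous_level := continuous_const, density_pos_on := fun x _ => hρ_pos x,
           level_pos_on := fun x _ => (hlevel x).1,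
           mem_interior_hull := fun x _ => (hlevel x).2 }
  · exact memLp_top_of_bound hρ.continuous.aestronglyMeasurable R (.of_forall hR)
  · exact memLp_top_of_bound hmc.aestronglyMeasurable M (.of_forall hM')
  · intro i j
    refine memLp_top_of_bound (hUe i j).aestronglyMeasurable N (.of_forall fun x => ?_)
    refine le_trans ?_ (hN' x)
    refine le_trans ?_ (Finset.single_le_sum (f := fun i => ∑ j,
      |(U x : Matrix (Fin n) (Fin n) ℝ) i j|) (fun i _ => by positivity) (Finset.mem_univ i))
    exact Finset.single_le_sum (f := fun j => |(U x : Matrix (Fin n) (Fin n) ℝ) i j|)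
      (fun j _ => by positivity) (Finset.mem_univ j)
  · exact memLp_top_const r
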